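/- Let $A$ be a free abelian group of finite rank and $\mathbb K$ a field of characteristic zero (for instance a subfield of $\mathbb C$); put $R=\mathbb Z[A]$ and let $\mathbb F_{\mathbb K}=\mathrm{Quot}(\mathbb K[A])$ be the field of fractions of the group ring $\mathbb K[A]$. For a path-connected space $Z$ and a homomorphism $\alpha:\pi_1(Z)\to A$, an $\alpha$-cover of $Z$ is a (not necessarily connected) covering $\tilde Z\to Z$ with an action of $A$ on $\tilde Z$ by homeomorphisms which is simply transitive on each fibre, such that for every loop $\gamma$ at the base point $z_0$ and every point $e$ over $z_0$ the lift of $\gamma$ starting at $e$ ends at $\alpha([\gamma])\cdot e$. The singular chain complex $C_*(\tilde Z)$ is then a complex of $R$-modules, and the $\alpha$-twisted homology of $Z$ is the $\mathbb F_{\mathbb K}$-vector space $$\mathcal H^\alpha_i(Z;\mathbb F_{\mathbb K}):=H_i\bigl(C_*(\tilde Z)\otimes_R\mathbb F_{\mathbb K}\bigr).$$ Theorem (Künneth formula). Let $X$ and $Y$ be path-connected topological spaces, let $p:X\times Y\to Y$ be the projection, let $\alpha:\pi_1(Y)\to A$ be a homomorphism and put $\alpha':=\alpha\circ\pi_1(p):\pi_1(X\times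 Y)\to A$. Then, for any $\alpha$-cover of $Y$ and any $\alpha'$-cover of $X\times Y$ and every $i\ge 0$, there is an isomorphism of $\mathbb F_{\mathbb K}$-vector spaces $$\mathcal H^{\alpha'}_i(X\times Y;\mathbb F_{\mathbb K})\;\cong\;\bigoplus_{j+k=i}H_j(X;\mathbb Q)\otimes_{\mathbb Q}\mathcal H^{\alpha}_k(Y;\mathbb F_{\mathbb K}).$$ -/

import Mathlib

open CategoryTheory
open scoped TensorProduct DirectSum

universe u v w z a k

/-- `IsAlphaCover α p` says that `p : E → X`, with the given action of the (multiplicatively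
written, discrete) group `A` on `E` by homeomorphisms, is the `α`-cover of the pointed space
`(X, x₀)`: a covering map on whose fibres `A` acts simply transitively, and whose monodromy at
`x₀` is `α`.  The total space `E` need not be connected. -/
structure IsAlphaCover {A : Type a} [CommGroup A] {X : Type u} [TopologicalSpace X] {x₀ : X}
    (α : FundamentalGroup X x₀ →* A) {E : Type v} [TopologicalSpace E] [MulAction A E]
    [ContinuousConstSMul A E] (p : C(E, X)) : Prop where
  isCoveringMap : IsCoveringMap p
  surjective : Function.Surjective p
  map_smul : ∀ (g : A) (e : E), p (g • e) = p e
  free : ∀ (g : A) (e : E), g • e = e → g = 1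
  transitive : ∀ e e' : E, p e = p e' → ∃ g : A, g • e = e'
  /-- The lift, with initial point `e` over `x₀`, of a loop `γ` at `x₀` ends at `α [γ] • e`. -/
  monodromy : ∀ (e e' : E) (γ' : Path e e') (he : x₀ = p e) (he' : x₀ = p e'),
    e' = α (FundamentalGroup.fromPath
      (Path.Homotopic.Quotient.mk ((γ'.map p.continuous).cast he he'))) • e

section TwistedHomology

/-- The singular `n`-simplices of `E`.  A group acting on `E` by homeomorphisms acts on them by
`(g • σ) t = g • σ t`. -/
abbrev SingularSimplex (E : Type v) [TopologicalSpace E] (n : SimplexCategory) : Type v :=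
  C(SimplexCategory.toTop₀.obj n, E)

/-- The action of `A` on the free abelian group on the singular `n`-simplices of `E`. -/
noncomputable def singularChainRep (A : Type a) [CommGroup A] (E : Type v) [TopologicalSpace E]
    [MulAction A E] [ContinuousConstSMul A E] (n : SimplexCategory) :
    Representation ℤ A (SingularSimplex E n →₀ ℤ) where
  toFun g := Finsupp.lmapDomain ℤ ℤ (fun σ => g • σ)
  map_one' := by ext; simp
  map_mul' g h := by ext; simp [mul_smul]

/-- The singular chains of `E` with the action of `A`, as a simplicial object: `f : m ⟶ n` acts by
precomposing singular simplices with the induced map from the `m`-simplex to the `n`-simplex. -/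
noncomputable def simplicialSingularChains (A : Type a) [CommGroup A] (E : Type v)
    [TopologicalSpace E] [MulAction A E] [ContinuousConstSMul A E] :
    SimplicialObject (Rep.{v} ℤ A) where
  obj n := Rep.of (singularChainRep A E n.unop)
  map f := Rep.ofHom
    { Finsupp.lmapDomain ℤ ℤ (fun σ : SingularSimplex E _ =>
        σ.comp (SimplexCategory.toTop₀.map f.unop).hom) with
      isIntertwining' := fun g => by
        refine Finsupp.lhom_ext fun σ r => ?_
        simp only [singularChainRep, MonoidHom.coe_mk, OneHom.coe_mk, LinearMap.comp_apply,
          Finsupp.lmapDomain_apply, Finsupp.mapDomain_single, ContinuousMap.smul_comp] }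
  map_id n := by
    refine Rep.hom_ext (DFunLike.ext _ _ fun c => ?_)
    change Finsupp.mapDomain _ c = c
    conv_rhs => rw [← Finsupp.mapDomain_id (v := c)]
    congr 1
    funext σ
    exact congrArg (fun f => σ.comp (TopCat.Hom.hom f)) (SimplexCategory.toTop₀.map_id n.unop)
  map_comp f g := by
    refine Rep.hom_ext (DFunLike.ext _ _ fun c => ?_)
    change Finsupp.mapDomain _ c = Finsupp.mapDomain _ (Finsupp.mapDomain _ c)
    rw [← Finsupp.mapDomain_comp]
    congr 1
    funext σ
    exact congrArg (fun f => σ.comp (TopCat.Hom.hom f))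
      (SimplexCategory.toTop₀.map_comp g.unop f.unop)

/-- The singular chain complex `C_*(E)` as a complex of modules over the group ring `ℤ[A]`. -/
noncomputable def equivariantSingularChains (A : Type a) [CommGroup A] (E : Type v)
    [TopologicalSpace E] [MulAction A E] [ContinuousConstSMul A E] :
    ChainComplex (ModuleCat.{v} (MonoidAlgebra ℤ A)) ℕ :=
  (AlgebraicTopology.alternatingFaceMapComplex _).obj
    (simplicialSingularChains A E ⋙ Rep.toModuleMonoidAlgebra)

/-- The fraction field `Quot(𝕂[A])` of the group ring of a free abelian group `A`. -/
abbrev FracGroupRing (K : Type k) [Field K] (A : Type a) [CommGroup A] : Type (max k a) :=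
  FractionRing (MonoidAlgebra K A)

/-- The canonical ring homomorphism `ℤ[A] → 𝕂[A] → Quot(𝕂[A])`. -/
noncomputable def groupRingToFrac (K : Type k) [Field K] (A : Type a) [CommGroup A] :
    MonoidAlgebra ℤ A →+* FracGroupRing K A :=
  (algebraMap (MonoidAlgebra K A) (FracGroupRing K A)).comp
    (MonoidAlgebra.mapRingHom A (Int.castRingHom K))

instance extendScalars_additive {R : Type u} {S : Type w} [CommRing R] [CommRing S]
    (f : R →+* S) : (ModuleCat.extendScalars.{u, w, v} f).Additive where
  map_add {M N g h} := by
    let := f.toAlgebra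
    refine ModuleCat.hom_ext ?_
    exact LinearMap.baseChange_add g.hom h.hom

/-- The twisted homology `H_i(C_*(E) ⊗_{ℤ[A]} Quot(𝕂[A]))`, a module over `Quot(𝕂[A])`.
For the `α`-cover `E` of `X` this is the `α`-twisted homology of `X`. -/
noncomputable def TwistedHomology (K : Type k) [Field K] (A : Type a) [CommGroup A] (E : Type v)
    [TopologicalSpace E] [MulAction A E] [ContinuousConstSMul A E] (i : ℕ) :
    ModuleCat.{max v k a} (FracGroupRing K A) :=
  ((((ModuleCat.extendScalars.{a, max k a, v} (groupRingToFrac K A)).mapHomologicalComplex _).obj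
    (equivariantSingularChains A E)).homology i)

/-- The rational vector space underlying the twisted homology. -/
noncomputable instance (K : Type k) [Field K] [CharZero K] (A : Type a) [CommGroup A]
    (E : Type v) [TopologicalSpace E] [MulAction A E] [ContinuousConstSMul A E] (i : ℕ) :
    Module ℚ (TwistedHomology K A E i) :=
  Module.compHom _ (algebraMap ℚ (FracGroupRing K A))

instance (K : Type k) [Field K] [CharZero K] (A : Type a) [CommGroup A]
    (E : Type v) [TopologicalSpace E] [MulAction A E] [ContinuousConstSMul A E] (i : ℕ) :
    IsScalarTower ℚ (FracGroupRing K A) (TwistedHomology K A E i) :=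
  ⟨fun q x m => by
    rw [Algebra.smul_def, mul_smul]
    rfl⟩

/-- Singular homology `H_j(X; ℚ)` of a space. -/
noncomputable abbrev RationalHomology (X : Type u) [TopologicalSpace X] (j : ℕ) :
    ModuleCat.{u} ℚ :=
  ((AlgebraicTopology.singularHomologyFunctor (ModuleCat.{u} ℚ) j).obj
    (ModuleCat.of ℚ (ULift.{u} ℚ))).obj (TopCat.of X)

end TwistedHomology

/-! The singular simplices of the cover of `X × Y` are the pairs of a simplex of `X` and a simplex
of the cover of `Y`, compatibly with the operators and with `A`. This comes from path lifting and
the contractibility of simplices. No local connectedness is assumed, so the covers are compared only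
through maps from contractible spaces: the set map `ψ` of `exists_comparison` is shown to be
continuous only after composition with such maps.

In each degree the twisted chains of the product are therefore the tensor product over `ℚ` of the
twisted chains `T` of `Y` with the rational chains of `X`. This is the diagonal of the simplicial
functor `S : V ↦ V ⊗ C(X; ℚ)` and of `T`. It remains to compute the homology of such a diagonal
(`nonempty_homologyOf_diagonal_equiv`), which is done by dimension shifting, without shuffle maps.

Over a field, `T` splits into a constant object, its components, and a reduced part. The reduced
part is a quotient of a based path object, cut out of the décalage, and the kernel is the object
`loops T`. Any functor to chain complexes that is exact and turns homotopies into equalities on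
homology kills based paths. It thus identifies `H_{i+1}` of the reduced part with `H_i` of the
loops. Both the plain chain complex and the diagonal with `S` are such functors. The first gives
`H_{k+1}(T) ≅ H_k(loops T)` and `H_0(T)` = components; the second then gives, by induction on the
degree, the sum of the homologies of `S` with coefficients in `H_k(T)`. By flatness over `ℚ` these
are `H_k(T) ⊗ H_j(X; ℚ)`. -/

section

/-! ### Cones in the simplex category and the contraction of the décalage -/

open Opposite Simplicial Limits

namespace SimplexCategory

/-- `Acts f φ` says that the operator `f` is given by `φ` on the values of the vertices. -/
def Acts {m n : SimplexCategory} (f : m ⟶ n) (φ : ℕ → ℕ) : Prop :=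
  ∀ i, (f.toOrderHom i).val = φ i.val

namespace Acts

variable {l m n : SimplexCategory}

lemma id (n : SimplexCategory) : Acts (𝟙 n) fun k => k := fun _ => rfl

lemma comp {f : l ⟶ m} {g : m ⟶ n} {φ ψ : ℕ → ℕ} (hf : Acts f φ) (hg : Acts g ψ) :
    Acts (f ≫ g) fun k => ψ (φ k) := fun i => (hg _).trans (congrArg ψ (hf i))

lemma ext {f g : m ⟶ n} {φ ψ : ℕ → ℕ} (hf : Acts f φ) (hg : Acts g ψ)
    (h : ∀ k ≤ m.len, φ k = ψ k) : f = g := by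
  ext i : 3
  refine Fin.ext ?_
  rw [hf, hg]
  exact h _ (Nat.le_of_lt_succ i.isLt)

lemma δ {n : ℕ} (i : Fin (n + 2)) :
    Acts (SimplexCategory.δ i) fun k => if k < i.val then k else k + 1 := by
  intro j
  change (i.succAbove j).val = _
  simp only [Fin.succAbove, Fin.lt_def, Fin.val_castSucc]
  split_ifs <;> rfl

lemma σ {n : ℕ} (i : Fin (n + 1)) :
    Acts (SimplexCategory.σ i) fun k => if k ≤ i.val then k else k - 1 := by
  intro j
  change (i.predAbove j).val = _
  simp only [Fin.predAbove, Fin.lt_def, Fin.val_castSucc]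
  split_ifs <;> first | rfl | omega

end Acts

/-- The action on vertices of the cone on an operator. -/
def coneFun {m n : ℕ} (f : Fin (m + 1) →o Fin (n + 1)) : Fin (m + 1 + 1) →o Fin (n + 1 + 1) where
  toFun := Fin.cases 0 fun i => (f i).succ
  monotone' i j h := by
    induction i using Fin.cases with
    | zero => exact Fin.zero_le _
    | succ i =>
      induction j using Fin.cases with
      | zero => simp at h
      | succ j =>
        simp only [Fin.cases_succ, Fin.succ_le_succ_iff] at h ⊢
        exact f.monotone h

/-- The endofunctor `⦋n⦌ ↦ ⦋0⦌ ⋆ ⦋n⦌ = ⦋n + 1⦌` of the simplex category, which adjoins a new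
initial vertex. -/
def cone : SimplexCategory ⥤ SimplexCategory where
  obj n := .mk (n.len + 1)
  map f := .mk (coneFun f.toOrderHom)
  map_id n := by
    ext i : 3
    exact i.cases rfl fun _ => rfl
  map_comp f g := by
    ext i : 3
    exact i.cases rfl fun _ => rfl

/-- The base inclusion `⦋n⦌ ⟶ ⦋0⦌ ⋆ ⦋n⦌`. -/
def coneBase : 𝟭 SimplexCategory ⟶ cone where
  app n := .mk ⟨Fin.succ, fun _ _ h => Fin.succ_le_succ_iff.2 h⟩
  naturality m n f := by ext i; rfl

/-- The vertex inclusion `⦋0⦌ ⟶ ⦋0⦌ ⋆ ⦋n⦌`. -/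
def coneVertex : (Functor.const _).obj ⦋0⦌ ⟶ cone where
  app n := .mk ⟨fun _ => 0, fun _ _ _ => le_rfl⟩
  naturality m n f := by ext i; rfl

/-- The collapse `⦋0⦌ ⋆ ⦋n⦌ ⟶ ⦋0⦌`. -/
def coneCollapse : cone ⟶ (Functor.const _).obj ⦋0⦌ where
  app n := .mk ⟨fun _ => 0, fun _ _ _ => le_rfl⟩
  naturality m n f := by ext i; rfl

/-- The operators of the contraction of `⦋0⦌ ⋆ ⦋n⦌` onto its vertex. -/
def coneContraction {n : ℕ} (i : Fin (n + 1)) : cone.obj ⦋n + 1⦌ ⟶ cone.obj ⦋n⦌ :=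
  .mk (a := ⦋n + 2⦌) (b := ⦋n + 1⦌)
    -- The index `i` counts vertices of the base, which sit one place higher in the cone; hence the
    -- bound `i + 1`. Base vertices up to `i` are crushed onto the cone vertex.
    { toFun j := ⟨if j.val ≤ i.val + 1 then 0 else j.val - 1, by
        have : j.val < n + 2 + 1 := j.isLt
        change _ < n + 1 + 1
        split_ifs <;> omega⟩
      monotone' a b h := by
        have : a.val ≤ b.val := h
        rw [Fin.mk_le_mk]
        split_ifs <;> omega }

namespace Acts

lemma coneMap {m n : SimplexCategory} {f : m ⟶ n} {φ : ℕ → ℕ} (h : Acts f φ) :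
    Acts (cone.map f) fun k => if k = 0 then 0 else φ (k - 1) + 1 :=
  Fin.cases rfl fun i => by
    change (f.toOrderHom i).val + 1 = _
    simp [h i]

lemma coneContraction {n : ℕ} (i : Fin (n + 1)) :
    Acts (SimplexCategory.coneContraction i) fun k => if k ≤ i.val + 1 then 0 else k - 1 :=
  fun _ => rfl

end Acts

end SimplexCategory

open SimplexCategory

namespace CategoryTheory.SimplicialObject

variable {C : Type*} [Category* C]

/-- The décalage of a simplicial object: `(dec T)ₙ = Tₙ₊₁`, forgetting the initial vertex. -/
abbrev dec (T : SimplicialObject C) : SimplicialObject C := cone.op ⋙ T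

/-- The projection of the décalage, given by the `0`-th face. -/
def decπ (T : SimplicialObject C) : dec T ⟶ T where
  app n := T.map (coneBase.app n.unop).op
  naturality m n f := by
    dsimp
    rw [← T.map_comp, ← T.map_comp]
    exact congrArg T.map (congrArg Quiver.Hom.op (coneBase.naturality f.unop)).symm

/-- The map from the décalage to the constant object given by the adjoined vertex. -/
def decVertex (T : SimplicialObject C) : dec T ⟶ (const C).obj (T _⦋0⦌) where
  app n := T.map (coneVertex.app n.unop).op
  naturality m n f := by
    dsimp
    rw [← T.map_comp, Category.comp_id]
    exact congrArg T.map (congrArg Quiver.Hom.op (coneVertex.naturality f.unop)).symm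

/-- The inclusion of the constant object in the décalage. -/
def decConst (T : SimplicialObject C) : (const C).obj (T _⦋0⦌) ⟶ dec T where
  app n := T.map (coneCollapse.app n.unop).op
  naturality m n f := by
    dsimp
    rw [← T.map_comp, Category.id_comp]
    exact congrArg T.map (congrArg Quiver.Hom.op (coneCollapse.naturality f.unop)).symm

@[simp]
lemma decConst_decVertex (T : SimplicialObject C) : decConst T ≫ decVertex T = 𝟙 _ := by
  refine NatTrans.ext (funext fun n => ?_)
  change T.map _ ≫ T.map _ = 𝟙 (T.obj _)
  rw [← T.map_comp, ← T.map_id]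
  refine congrArg (fun f => T.map (Quiver.Hom.op f)) (SimplexCategory.Hom.ext _ _ ?_)
  exact Subsingleton.elim (α := Fin 1 →o Fin 1) _ _

/-- The décalage contracts onto the constant object. -/
def decHomotopy (T : SimplicialObject C) :
    SimplicialObject.Homotopy (decVertex T ≫ decConst T) (𝟙 (dec T)) where
  -- Each homotopy identity below is an equality of two operators; `Acts.ext` turns it into
  -- arithmetic of natural numbers on the vertices.
  h i := T.map (coneContraction i).op
  h_zero_comp_δ_zero n := by
    change T.map _ ≫ T.map _ = 𝟙 (T.obj _)
    rw [← T.map_comp, ← T.map_id]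
    refine congrArg (fun f => T.map (Quiver.Hom.op f))
      (((Acts.δ _).coneMap.comp (.coneContraction _)).ext (.id _) fun k hk => ?_)
    grind
  h_last_comp_δ_last n := by
    change T.map _ ≫ T.map _ = T.map _ ≫ T.map _
    rw [← T.map_comp, ← T.map_comp]
    refine congrArg (fun f => T.map (Quiver.Hom.op f))
      (((Acts.δ _).coneMap.comp (.coneContraction _)).ext (ψ := fun _ => 0) (fun _ => rfl)
        fun k hk => ?_)
    change k ≤ n + 1 at hk
    grind
  h_succ_comp_δ_castSucc_of_lt i j hij := by
    change T.map _ ≫ T.map _ = T.map _ ≫ T.map _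
    rw [← T.map_comp, ← T.map_comp]
    refine congrArg (fun f => T.map (Quiver.Hom.op f))
      (((Acts.δ _).coneMap.comp (.coneContraction _)).ext
        ((Acts.coneContraction _).comp (Acts.δ _).coneMap) fun k hk => ?_)
    rw [Fin.le_def] at hij
    grind
  h_succ_comp_δ_castSucc_succ j := by
    change T.map _ ≫ T.map _ = T.map _ ≫ T.map _
    rw [← T.map_comp, ← T.map_comp]
    refine congrArg (fun f => T.map (Quiver.Hom.op f))
      (((Acts.δ _).coneMap.comp (.coneContraction _)).ext
        ((Acts.δ _).coneMap.comp (.coneContraction _)) fun k hk => ?_)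
    grind
  h_castSucc_comp_δ_succ_of_lt i j hji := by
    change T.map _ ≫ T.map _ = T.map _ ≫ T.map _
    rw [← T.map_comp, ← T.map_comp]
    refine congrArg (fun f => T.map (Quiver.Hom.op f))
      (((Acts.δ _).coneMap.comp (.coneContraction _)).ext
        ((Acts.coneContraction _).comp (Acts.δ _).coneMap) fun k hk => ?_)
    rw [Fin.lt_def] at hji
    grind
  h_comp_σ_castSucc_of_le i j hij := by
    change T.map _ ≫ T.map _ = T.map _ ≫ T.map _
    rw [← T.map_comp, ← T.map_comp]
    refine congrArg (fun f => T.map (Quiver.Hom.op f))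
      (((Acts.σ _).coneMap.comp (.coneContraction _)).ext
        ((Acts.coneContraction _).comp (Acts.σ _).coneMap) fun k hk => ?_)
    rw [Fin.le_def] at hij
    grind
  h_comp_σ_succ_of_lt i j hji := by
    change T.map _ ≫ T.map _ = T.map _ ≫ T.map _
    rw [← T.map_comp, ← T.map_comp]
    refine congrArg (fun f => T.map (Quiver.Hom.op f))
      (((Acts.σ _).coneMap.comp (.coneContraction _)).ext
        ((Acts.coneContraction _).comp (Acts.σ _).coneMap) fun k hk => ?_)
    rw [Fin.le_def] at hji
    grind

end CategoryTheory.SimplicialObject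

end

/-! ### Components, based paths and loops of a simplicial object -/

section

open Opposite Simplicial Limits
open SimplexCategory

namespace CategoryTheory.SimplicialObject

section

variable {C : Type*} [Category* C]

lemma eq_of_hom_zero {m : SimplexCategory} (f g : m ⟶ ⦋0⦌) : f = g :=
  SimplexCategory.isTerminalZero.hom_ext f g

/-- The retraction of `⦋0⦌ ⋆ ⦋n⦌` onto its base. -/
def coneRetract (n : SimplexCategory) : cone.obj n ⟶ n :=
  .mk (a := cone.obj n) (b := n) ⟨fun i : Fin (n.len + 2) => i.cases 0 id,
    fun i j h => by
      induction i using Fin.cases with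
      | zero => exact Fin.zero_le _
      | succ i =>
        induction j using Fin.cases with
        | zero => simp at h
        | succ j => exact Fin.succ_le_succ_iff.1 h⟩

lemma coneBase_coneRetract (n : SimplexCategory) : coneBase.app n ≫ coneRetract n = 𝟙 n := by
  ext i : 3
  rfl

/-- The initial vertices of the source and the target of an operator are joined by an edge. -/
lemma exists_edge {m n : SimplexCategory} (f : m ⟶ n) :
    ∃ h : ⦋1⦌ ⟶ n, SimplexCategory.δ 0 ≫ h = SimplexCategory.const ⦋0⦌ m 0 ≫ f ∧
      SimplexCategory.δ 1 ≫ h = SimplexCategory.const ⦋0⦌ n 0 := by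
  let g : Fin 2 →o Fin (n.len + 1) :=
    ⟨fun i => if i = 0 then 0 else f.toOrderHom 0, fun i j h => by
      by_cases h1 : i = 0
      · simp [h1]
      · have h2 : j ≠ 0 := fun h2 => h1 (by simpa [h2] using h)
        simp [h1, h2]⟩
  refine ⟨.mk (a := ⦋1⦌) g, ?_, ?_⟩ <;> (ext i : 3; fin_cases i; rfl)

end

variable {C : Type*} [Category* C] [Abelian C]

/-- The difference of the two faces of the edges. -/
def edgeBoundary (T : SimplicialObject C) : T _⦋1⦌ ⟶ T _⦋0⦌ := T.δ 0 - T.δ 1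

lemma edgeBoundary_naturality {T T' : SimplicialObject C} (f : T ⟶ T') :
    f.app _ ≫ edgeBoundary T' = edgeBoundary T ≫ f.app _ := by
  simp only [edgeBoundary, Preadditive.comp_sub, Preadditive.sub_comp,
    SimplicialObject.δ_naturality]

/-- The components of a simplicial object. -/
noncomputable abbrev components (T : SimplicialObject C) : C := cokernel (edgeBoundary T)

/-- The map of a simplicial object to its components. -/
noncomputable def toComponents (T : SimplicialObject C) : T ⟶ (const C).obj (components T) where
  app n := T.map (SimplexCategory.const ⦋0⦌ n.unop 0).op ≫ cokernel.π (edgeBoundary T)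
  naturality m n f := by
    obtain ⟨h, h1, h2⟩ := exists_edge f.unop
    -- The two vertices to be compared are the ends of the edge `h`, so they differ by an edge
    -- boundary, which the cokernel kills.
    have key : T.map h.op ≫ T.δ 0 ≫ cokernel.π (edgeBoundary T) =
        T.map h.op ≫ T.δ 1 ≫ cokernel.π (edgeBoundary T) := by
      rw [← sub_eq_zero, ← Preadditive.comp_sub, ← Preadditive.sub_comp, ← edgeBoundary,
        cokernel.condition, comp_zero]
    simp only [SimplicialObject.δ, ← T.map_comp_assoc, ← op_comp, h1, h2] at key
    change T.map f ≫ T.map _ ≫ cokernel.π (edgeBoundary T) = (_ ≫ _) ≫ 𝟙 (components T)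
    rw [Category.comp_id, ← key, op_comp, T.map_comp_assoc, Quiver.Hom.op_unop]

/-- The map of a constant object determined by its value in degree `0`. -/
def ofConst {T : SimplicialObject C} {V : C} (f : V ⟶ T _⦋0⦌) : (const C).obj V ⟶ T where
  app n := f ≫ T.map (SimplexCategory.const n.unop ⦋0⦌ 0).op
  naturality m n g := by
    rw [Category.assoc, ← T.map_comp]
    exact Category.id_comp _

lemma ofConst_toComponents {T : SimplicialObject C} (f : components T ⟶ T _⦋0⦌)
    (hf : f ≫ cokernel.π (edgeBoundary T) = 𝟙 _) : ofConst f ≫ toComponents T = 𝟙 _ := by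
  refine NatTrans.ext (funext fun n => ?_)
  change (f ≫ T.map _) ≫ T.map _ ≫ cokernel.π (edgeBoundary T) = 𝟙 (components T)
  rw [Category.assoc, ← T.map_comp_assoc, ← op_comp, eq_of_hom_zero (_ ≫ _) (𝟙 _),
    op_id, T.map_id, Category.id_comp, hf]

/-- The sequence `ker r ⟶ T ⟶ T'` for a retraction `r`. -/
noncomputable abbrev kernelSequence {A : Type*} [Category* A] [Abelian A] {T T' : A} (r : T ⟶ T') :
    ShortComplex A :=
  .mk (kernel.ι r) r (kernel.condition r)

/-- A section of `r` splits the sequence `ker r ⟶ T ⟶ T'`. -/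
noncomputable def kernelSplitting {A : Type*} [Category* A] [Abelian A] {T T' : A} (r : T ⟶ T')
    (s : T' ⟶ T) (h : s ≫ r = 𝟙 _) : (kernelSequence r).Splitting :=
  .ofExactOfSection _ (ShortComplex.exact_kernel r) s h (by dsimp; infer_instance)

/-- The based paths: the kernel of the vertex map of the décalage. -/
noncomputable abbrev paths (T : SimplicialObject C) : SimplicialObject C := kernel (decVertex T)

/-- The endpoint map of the based paths. -/
noncomputable abbrev pathsπ (T : SimplicialObject C) : paths T ⟶ T :=
  kernel.ι (decVertex T) ≫ decπ T

/-- The based paths are a retract of the décalage. -/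
noncomputable def pathsSplitting (T : SimplicialObject C) :
    (kernelSequence (decVertex T)).Splitting :=
  kernelSplitting _ (decConst T) (decConst_decVertex T)

/-- Based path objects map onto a simplicial object without components. -/
lemma epi_pathsπ [∀ X : C, Projective X] (T : SimplicialObject C) [Epi (edgeBoundary T)] :
    Epi (pathsπ T) := by
  -- `w` assigns to a vertex an edge from it to zero. If `t` is a section of the edge boundary, the
  -- degenerate edge at the end of `t` minus `t` ends at zero and starts at the given vertex.
  obtain ⟨w, hw1, hw2⟩ : ∃ w : T _⦋0⦌ ⟶ T _⦋1⦌, w ≫ T.δ 0 = 0 ∧ w ≫ T.δ 1 = 𝟙 _ := by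
    let t := Projective.factorThru (𝟙 _) (edgeBoundary T)
    have ht : t ≫ edgeBoundary T = 𝟙 _ := Projective.factorThru_comp _ _
    refine ⟨t ≫ T.δ 0 ≫ T.σ 0 - t, ?_, ?_⟩
    · have h : T.σ (n := 0) 0 ≫ T.δ 0 = 𝟙 _ := T.δ_comp_σ_self (i := 0)
      simp only [Preadditive.sub_comp, Category.assoc, h, Category.comp_id, sub_self]
    · have h : T.σ (n := 0) 0 ≫ T.δ 1 = 𝟙 _ := T.δ_comp_σ_succ (i := 0)
      rw [← ht, edgeBoundary, Preadditive.comp_sub, Preadditive.sub_comp, Category.assoc,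
        Category.assoc, h, Category.comp_id]
  obtain ⟨w, hw1, hw2⟩ : ∃ w : T _⦋0⦌ ⟶ (dec T).obj (op ⦋0⦌),
      w ≫ (decπ T).app (op ⦋0⦌) = 0 ∧ w ≫ (decVertex T).app (op ⦋0⦌) = 𝟙 (T _⦋0⦌) :=
    ⟨w, .trans (congrArg (fun f => w ≫ T.map (Quiver.Hom.op f)) (by ext i : 3; rfl)) hw1,
      .trans (congrArg (fun f => w ≫ T.map (Quiver.Hom.op f)) (by ext i : 3; fin_cases i; rfl)) hw2⟩
  suffices ∀ n, Epi ((pathsπ T).app n) from NatTrans.epi_of_epi_app _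
  intro n
  let p : T.obj n ⟶ (dec T).obj n := T.map (coneRetract n.unop).op
  have hp : p ≫ (decπ T).app n = 𝟙 _ := by
    change T.map _ ≫ T.map _ = 𝟙 (T.obj _)
    rw [← T.map_comp, ← T.map_id, ← op_comp, coneBase_coneRetract]
    rfl
  -- The degenerate section `p` of the endpoint map has initial vertex `q`, possibly nonzero.
  -- Subtracting the degeneracy of the edge from `q` to zero makes the initial vertex vanish and
  -- leaves the endpoint unchanged.
  obtain ⟨e, he1, he2⟩ : ∃ e : T.obj n ⟶ (dec T).obj n,
      e ≫ (decπ T).app n = 𝟙 _ ∧ e ≫ (decVertex T).app n = 0 := by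
    let d : n.unop ⟶ ⦋0⦌ := SimplexCategory.const _ _ 0
    have h1 : (dec T).map d.op ≫ (decπ T).app n = (decπ T).app (op ⦋0⦌) ≫ T.map d.op :=
      (decπ T).naturality d.op
    have h2 : (dec T).map d.op ≫ (decVertex T).app n = (decVertex T).app (op ⦋0⦌) :=
      ((decVertex T).naturality d.op).trans (Category.comp_id _)
    let q : T.obj n ⟶ T _⦋0⦌ := p ≫ (decVertex T).app n
    refine ⟨p - q ≫ w ≫ (dec T).map d.op, ?_, ?_⟩
    · refine (Preadditive.sub_comp _ _ _).trans ?_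
      simp only [Category.assoc]
      rw [hp, h1, reassoc_of% hw1, zero_comp, comp_zero, sub_zero]
    · refine (Preadditive.sub_comp _ _ _).trans (sub_eq_zero.2 ?_)
      simp only [Category.assoc]
      rw [h2]
      exact ((congrArg (q ≫ ·) hw2).trans (Category.comp_id _)).symm
  have h2 : (pathsSplitting T).r.app n ≫ (kernel.ι (decVertex T)).app n =
      𝟙 _ - (decVertex T).app n ≫ (decConst T).app n :=
    NatTrans.congr_app (pathsSplitting T).r_f n
  have h3 : e ≫ (𝟙 _ - (decVertex T).app n ≫ (decConst T).app n) = e := by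
    refine (Preadditive.comp_sub _ _ _).trans ?_
    rw [reassoc_of% he2, zero_comp, sub_zero, Category.comp_id]
  -- Since `e` has initial vertex zero, projecting it to the based paths loses nothing, so `e ≫ r`
  -- is a section in degree `n`.
  refine epi_of_epi_fac (f := e ≫ (pathsSplitting T).r.app n) (h := 𝟙 _) ?_
  change (e ≫ _) ≫ _ ≫ _ = _
  rw [Category.assoc, reassoc_of% h2, reassoc_of% h3, he1]

/-- The part of a simplicial object with trivial components. -/
noncomputable abbrev reduced (T : SimplicialObject C) : SimplicialObject C :=
  kernel (toComponents T)

/-- The section of the map to the components. -/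
noncomputable def componentsSection [∀ X : C, Projective X] (T : SimplicialObject C) :
    (const C).obj (components T) ⟶ T :=
  ofConst (Projective.factorThru (𝟙 _) (cokernel.π (edgeBoundary T)))

/-- A simplicial object is the sum of its components and its reduced part. -/
noncomputable def reducedSplitting [∀ X : C, Projective X] (T : SimplicialObject C) :
    (kernelSequence (toComponents T)).Splitting :=
  kernelSplitting _ (componentsSection T) (ofConst_toComponents _ (Projective.factorThru_comp _ _))

/-- A map that kills the edge boundaries of the reduced part extends along the retraction `r` to a
map on the vertices of `T` that factors through the components. The reduced part goes to zero there,
so the map is zero. -/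
lemma epi_edgeBoundary_reduced [∀ X : C, Projective X] (T : SimplicialObject C) :
    Epi (edgeBoundary (reduced T)) := by
  have h := edgeBoundary_naturality (reducedSplitting T).r
  have h1 : (kernel.ι (toComponents T)).app (op ⦋0⦌) ≫ (reducedSplitting T).r.app (op ⦋0⦌) = 𝟙 _ :=
    NatTrans.congr_app (reducedSplitting T).f_r (op ⦋0⦌)
  have h2 : (kernel.ι (toComponents T)).app (op ⦋0⦌) ≫ cokernel.π (edgeBoundary T) = 0 := by
    have := NatTrans.congr_app (kernel.condition (toComponents T)) (op ⦋0⦌)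
    refine Eq.trans ?_ this
    change _ = _ ≫ T.map _ ≫ _
    rw [eq_of_hom_zero (SimplexCategory.const _ _ 0) (𝟙 _), op_id]
    exact congrArg _ ((congrArg (· ≫ _) (T.map_id _)).trans (Category.id_comp _)).symm
  refine Preadditive.epi_of_cancel_zero _ fun g hg => ?_
  have h3 : edgeBoundary T ≫ (reducedSplitting T).r.app (op ⦋0⦌) ≫ g = 0 := by
    rw [← Category.assoc, ← h, Category.assoc, hg, comp_zero]
  rw [← Category.id_comp g, ← h1, Category.assoc, ← cokernel.π_desc _ _ h3, reassoc_of% h2,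
    zero_comp]

/-- The based loops of the reduced part. -/
noncomputable abbrev loops (T : SimplicialObject C) : SimplicialObject C :=
  kernel (pathsπ (reduced T))

end CategoryTheory.SimplicialObject

end

/-! ### Homological functors and dimension shifting -/

section

open Opposite Simplicial Limits
open SimplexCategory

namespace CategoryTheory.SimplicialObject

section

variable {C : Type*} [Category* C] [Abelian C] {D : Type*} [Category* D] [Abelian D]

/-- A functor from simplicial objects to chain complexes is homological if it is additive and
exact, and homotopic maps induce equal maps on homology. -/
class IsHomological (Φ : SimplicialObject C ⥤ ChainComplex D ℕ) [Φ.Additive] : Prop where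
  shortExact {X : ShortComplex (SimplicialObject C)} (hX : X.ShortExact) : (X.map Φ).ShortExact
  homologyMap_eq {T T' : SimplicialObject C} {f g : T ⟶ T'}
    (H : SimplicialObject.Homotopy f g) (i : ℕ) :
    HomologicalComplex.homologyMap (Φ.map f) i = HomologicalComplex.homologyMap (Φ.map g) i

variable (Φ : SimplicialObject C ⥤ ChainComplex D ℕ) [Φ.Additive]

/-- The homology of the complex attached to a simplicial object. -/
noncomputable abbrev homologyOf (i : ℕ) : SimplicialObject C ⥤ D :=
  Φ ⋙ HomologicalComplex.homologyFunctor D _ i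

variable [IsHomological Φ]

/-- On homology the identity of the décalage factors through the constant object. The based paths
are a summand of the décalage and the kernel of the map to that constant object, so their identity
induces zero. -/
lemma isZero_homologyOf_paths (T : SimplicialObject C) (i : ℕ) :
    IsZero ((homologyOf Φ i).obj (paths T)) := by
  have h1 : (homologyOf Φ i).map (decVertex T ≫ decConst T) = 𝟙 _ :=
    (IsHomological.homologyMap_eq (decHomotopy T) i).trans ((homologyOf Φ i).map_id (dec T))
  have h2 : kernel.ι (decVertex T) ≫ (pathsSplitting T).r = 𝟙 _ := (pathsSplitting T).f_r
  rw [IsZero.iff_id_eq_zero, ← (homologyOf Φ i).map_id, ← h2, (homologyOf Φ i).map_comp,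
    ← Category.id_comp ((homologyOf Φ i).map (pathsSplitting T).r), ← h1,
    ← (homologyOf Φ i).map_comp, ← (homologyOf Φ i).map_comp, Category.assoc,
    kernel.condition_assoc, zero_comp, Functor.map_zero]

variable [∀ X : C, Projective X]

lemma pathsSequence_shortExact (T : SimplicialObject C) [Epi (edgeBoundary T)] :
    (kernelSequence (pathsπ T)).ShortExact :=
  have := epi_pathsπ T
  { exact := ShortComplex.exact_kernel (pathsπ T)
    mono_f := by dsimp; infer_instance
    epi_g := by dsimp; infer_instance }

/-- An epimorphism of complexes in nonnegative degrees is an epimorphism on `H_0`, and `H_0` of the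
based paths vanishes. -/
lemma isZero_homologyOf_zero (T : SimplicialObject C) [Epi (edgeBoundary T)] :
    IsZero ((homologyOf Φ 0).obj T) := by
  have h := (IsHomological.shortExact (Φ := Φ) (pathsSequence_shortExact T)).epi_g
  have : Epi (HomologicalComplex.homologyMap (((kernelSequence (pathsπ T)).map Φ).g) 0) :=
    HomologicalComplex.epi_homologyMap_of_epi_of_not_rel _ _ (by simp)
  exact @IsZero.of_epi _ _ _ _ _ _ this (isZero_homologyOf_paths Φ T 0)

/-- If the edges of a simplicial object bound all vertices, its homology is the shifted homology
of the kernel of the path fibration. -/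
noncomputable def homologyOfIsoLoops (T : SimplicialObject C) [Epi (edgeBoundary T)] (i : ℕ) :
    (homologyOf Φ (i + 1)).obj T ≅ (homologyOf Φ i).obj (kernel (pathsπ T)) :=
  (IsHomological.shortExact (Φ := Φ) (pathsSequence_shortExact T)).δIso (i + 1) i (by simp)
    (isZero_homologyOf_paths Φ T _) (isZero_homologyOf_paths Φ T _)

/-- The splitting of homology induced by the splitting of a simplicial object into its reduced part
and its components. -/
noncomputable def homologyOfIsoBiprod (T : SimplicialObject C) (i : ℕ) :
    (homologyOf Φ i).obj T ≅
      (homologyOf Φ i).obj (reduced T) ⊞ (homologyOf Φ i).obj ((const C).obj (components T)) :=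
  ((reducedSplitting T).map (homologyOf Φ i)).isoBinaryBiproduct

/-- Homology in degree zero only depends on the components. -/
noncomputable def homologyOfZeroIso (T : SimplicialObject C) :
    (homologyOf Φ 0).obj T ≅ (homologyOf Φ 0).obj ((const C).obj (components T)) :=
  haveI := epi_edgeBoundary_reduced T
  homologyOfIsoBiprod Φ T 0 ≪≫ (isoZeroBiprod (isZero_homologyOf_zero Φ (reduced T))).symm

/-- Dimension shifting for a homological functor. -/
noncomputable def homologyOfSuccIso (T : SimplicialObject C) (i : ℕ) :
    (homologyOf Φ (i + 1)).obj T ≅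
      (homologyOf Φ i).obj (loops T) ⊞ (homologyOf Φ (i + 1)).obj ((const C).obj (components T)) :=
  haveI := epi_edgeBoundary_reduced T
  homologyOfIsoBiprod Φ T (i + 1) ≪≫
    biprod.mapIso (homologyOfIsoLoops Φ (reduced T) i) (Iso.refl _)

end

section

open AlgebraicTopology

variable {C : Type*} [Category* C] [Abelian C]

instance : IsHomological (alternatingFaceMapComplex C) where
  shortExact hX := HomologicalComplex.shortExact_of_degreewise_shortExact _ fun n =>
    hX.map_of_exact ((evaluation _ _).obj (op ⦋n⦌))
  homologyMap_eq H i := H.map_homology_eq i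

/-- The homology of a constant object in degree zero. -/
noncomputable def homologyConstZero (V : C) :
    (homologyOf (alternatingFaceMapComplex C) 0).obj ((const C).obj V) ≅ V :=
  (HomologicalComplex.homologyFunctor _ _ 0).mapIso
    (AlgebraicTopology.alternatingFaceMapComplexConst.app V) ≪≫
    ChainComplex.alternatingConstHomologyZero V

lemma isZero_homologyConst (V : C) (i : ℕ) :
    IsZero ((homologyOf (alternatingFaceMapComplex C) (i + 1)).obj ((const C).obj V)) :=
  (ChainComplex.alternatingConst_exactAt V (i + 1) (by simp)).isZero_homology.of_iso
    ((HomologicalComplex.homologyFunctor _ _ (i + 1)).mapIso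
    (AlgebraicTopology.alternatingFaceMapComplexConst.app V))

variable [∀ Z : C, Projective Z] (T : SimplicialObject C)

/-- The homology in degree zero is the object of components. -/
noncomputable def homologyZeroIsoComponents :
    (homologyOf (alternatingFaceMapComplex C) 0).obj T ≅ components T :=
  homologyOfZeroIso _ T ≪≫ homologyConstZero _

/-- Dimension shifting for the homology of a simplicial object. -/
noncomputable def homologySuccIsoLoops (i : ℕ) :
    (homologyOf (alternatingFaceMapComplex C) (i + 1)).obj T ≅
      (homologyOf (alternatingFaceMapComplex C) i).obj (loops T) :=
  homologyOfSuccIso _ T i ≪≫ (isoBiprodZero (isZero_homologyConst _ i)).symm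

end

end CategoryTheory.SimplicialObject

end

/-! ### The diagonal of a simplicial functor and its Künneth formula -/

section

open Opposite Simplicial Limits
open SimplexCategory

namespace CategoryTheory.SimplicialObject

section

variable {C : Type*} [Category* C] {D : Type*} [Category* D]

/-- The diagonal `n ↦ Sₙ(Tₙ)` of a simplicial functor `S` and a simplicial object `T`. -/
@[simps]
def diagObj (S : SimplicialObject (C ⥤ D)) (T : SimplicialObject C) : SimplicialObject D where
  obj n := (S.obj n).obj (T.obj n)
  map f := (S.obj _).map (T.map f) ≫ (S.map f).app _
  map_id n := by simp
  map_comp f g := by simp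

/-- The functor `T ↦ (n ↦ Sₙ(Tₙ))` for a simplicial functor `S`. -/
@[simps]
def diag (S : SimplicialObject (C ⥤ D)) : SimplicialObject C ⥤ SimplicialObject D where
  obj T := diagObj S T
  map {T T'} f :=
    { app n := (S.obj n).map (f.app n)
      naturality m n g := by
        change ((S.obj m).map (T.map g) ≫ (S.map g).app (T.obj n)) ≫ (S.obj n).map (f.app n) =
          (S.obj m).map (f.app m) ≫ (S.obj m).map (T'.map g) ≫ (S.map g).app (T'.obj n)
        rw [← Functor.map_comp_assoc, ← f.naturality, Functor.map_comp_assoc, Category.assoc,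
          (S.map g).naturality] }

/-- This interchange rule and the next separate each identity for a homotopy of diagonals into one
identity for `S` and one for `T`. -/
lemma diagHomotopy_aux {S : SimplicialObject (C ⥤ D)} {T T' : SimplicialObject C}
    {l m n : SimplexCategoryᵒᵖ} (s : S.obj l ⟶ S.obj m) (f : T.obj l ⟶ T'.obj m) (g : m ⟶ n) :
    ((S.obj l).map f ≫ s.app _) ≫ (diagObj S T').map g =
      (S.obj l).map (f ≫ T'.map g) ≫ (s ≫ S.map g).app _ := by
  change ((S.obj l).map f ≫ s.app (T'.obj m)) ≫ (S.obj m).map (T'.map g) ≫ (S.map g).app _ = _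
  simp

lemma diagHomotopy_aux' {S : SimplicialObject (C ⥤ D)} {T T' : SimplicialObject C}
    {l m n : SimplexCategoryᵒᵖ} (s : S.obj m ⟶ S.obj n) (f : T.obj m ⟶ T'.obj n) (g : l ⟶ m) :
    (diagObj S T).map g ≫ ((S.obj m).map f ≫ s.app _) =
      (S.obj l).map (T.map g ≫ f) ≫ (S.map g ≫ s).app _ := by
  change ((S.obj l).map (T.map g) ≫ (S.map g).app (T.obj m)) ≫ (S.obj m).map f ≫ s.app _ = _
  simp

/-- The diagonal preserves homotopies. -/
def diagHomotopy {S : SimplicialObject (C ⥤ D)} (K : SimplicialObject.Homotopy (𝟙 S) (𝟙 S))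
    {T T' : SimplicialObject C} {f g : T ⟶ T'} (H : SimplicialObject.Homotopy f g) :
    SimplicialObject.Homotopy ((diag S).map f) ((diag S).map g) where
  h i := (S.obj _).map (H.h i) ≫ (K.h i).app _
  h_zero_comp_δ_zero n := (diagHomotopy_aux (K.h 0) (H.h 0) _).trans <|
    (congrArg₂ (fun f s => (S.obj _).map f ≫ s.app _) (H.h_zero_comp_δ_zero n)
      (K.h_zero_comp_δ_zero n)).trans (Category.comp_id _)
  h_last_comp_δ_last n := (diagHomotopy_aux (K.h _) (H.h _) _).trans <|
    (congrArg₂ (fun f s => (S.obj _).map f ≫ s.app _) (H.h_last_comp_δ_last n)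
      (K.h_last_comp_δ_last n)).trans (Category.comp_id _)
  h_succ_comp_δ_castSucc_of_lt i j hij := (diagHomotopy_aux (K.h _) (H.h _) _).trans <|
    (congrArg₂ (fun f s => (S.obj _).map f ≫ s.app _) (H.h_succ_comp_δ_castSucc_of_lt i j hij)
      (K.h_succ_comp_δ_castSucc_of_lt i j hij)).trans (diagHomotopy_aux' (K.h j) (H.h j) _).symm
  h_succ_comp_δ_castSucc_succ j := (diagHomotopy_aux (K.h _) (H.h _) _).trans <|
    (congrArg₂ (fun f s => (S.obj _).map f ≫ s.app _) (H.h_succ_comp_δ_castSucc_succ j)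
      (K.h_succ_comp_δ_castSucc_succ j)).trans (diagHomotopy_aux (K.h _) (H.h _) _).symm
  h_castSucc_comp_δ_succ_of_lt i j hji := (diagHomotopy_aux (K.h _) (H.h _) _).trans <|
    (congrArg₂ (fun f s => (S.obj _).map f ≫ s.app _) (H.h_castSucc_comp_δ_succ_of_lt i j hji)
      (K.h_castSucc_comp_δ_succ_of_lt i j hji)).trans (diagHomotopy_aux' (K.h j) (H.h j) _).symm
  h_comp_σ_castSucc_of_le i j hij := (diagHomotopy_aux (K.h _) (H.h _) _).trans <|
    (congrArg₂ (fun f s => (S.obj _).map f ≫ s.app _) (H.h_comp_σ_castSucc_of_le i j hij)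
      (K.h_comp_σ_castSucc_of_le i j hij)).trans (diagHomotopy_aux' (K.h _) (H.h _) _).symm
  h_comp_σ_succ_of_lt i j hji := (diagHomotopy_aux (K.h _) (H.h _) _).trans <|
    (congrArg₂ (fun f s => (S.obj _).map f ≫ s.app _) (H.h_comp_σ_succ_of_lt i j hji)
      (K.h_comp_σ_succ_of_lt i j hji)).trans (diagHomotopy_aux' (K.h _) (H.h _) _).symm

end

section

open AlgebraicTopology

variable {C : Type*} [Category* C] [Abelian C] {D : Type*} [Category* D] [Abelian D]
  (S : SimplicialObject (C ⥤ D)) [∀ n, (S.obj n).Additive]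

instance : (diag S).Additive where
  map_add := NatTrans.ext (funext fun n => (S.obj n).map_add)

variable [∀ Z : C, Projective Z]

/-- The functors `Sₙ` are only additive, not exact. As all objects of `C` are projective, a short
exact sequence splits in each degree, and additive functors preserve split sequences. A homotopy is
paired with the constant homotopy of `S`. -/
instance : IsHomological (diag S ⋙ alternatingFaceMapComplex D) where
  shortExact {X} hX := HomologicalComplex.shortExact_of_degreewise_shortExact _ fun n => by
    have h : (X.map ((evaluation _ _).obj (op ⦋n⦌))).ShortExact :=
      hX.map_of_exact ((evaluation _ _).obj (op ⦋n⦌))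
    have := h.epi_g
    exact ((ShortComplex.Splitting.ofExactOfSection _ h.exact
      (Projective.factorThru (𝟙 _) (X.map ((evaluation _ _).obj (op ⦋n⦌))).g)
      (Projective.factorThru_comp _ _) h.mono_f).map (S.obj (op ⦋n⦌))).shortExact
  homologyMap_eq H i := (diagHomotopy (Homotopy.refl (𝟙 S)) H).map_homology_eq i

end

/-- Split the summand `(i + 1, 0)` off a sum over the antidiagonal. -/
theorem nonempty_antidiagonal_succ_equiv (R : Type*) [Semiring R] (M : ℕ → ℕ → Type*)
    [∀ j k, AddCommMonoid (M j k)] [∀ j k, Module R (M j k)] (i : ℕ) :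
    Nonempty ((⨁ jk : {jk : ℕ × ℕ // jk.1 + jk.2 = i + 1}, M jk.1.1 jk.1.2) ≃ₗ[R]
      (⨁ jk : {jk : ℕ × ℕ // jk.1 + jk.2 = i}, M jk.1.1 (jk.1.2 + 1)) × M (i + 1) 0) := by
  classical
  have hfin (i : ℕ) : Fintype {jk : ℕ × ℕ // jk.1 + jk.2 = i} :=
    Fintype.subtype (Finset.HasAntidiagonal.antidiagonal i) fun _ =>
      Finset.HasAntidiagonal.mem_antidiagonal
  refine ⟨DirectSum.linearEquivFunOnFintype R _ _ ≪≫ₗ ?_ ≪≫ₗ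
    (DirectSum.linearEquivFunOnFintype R _ _).symm.prodCongr (LinearEquiv.refl R _)⟩
  refine LinearEquiv.ofBijective (M := (jk : {jk : ℕ × ℕ // jk.1 + jk.2 = i + 1}) → M jk.1.1 jk.1.2)
    (M₂ := ((jk : {jk : ℕ × ℕ // jk.1 + jk.2 = i}) → M jk.1.1 (jk.1.2 + 1)) × M (i + 1) 0)
    { toFun f := (fun jk => f ⟨(jk.1.1, jk.1.2 + 1), by have := jk.2; omega⟩, f ⟨(i + 1, 0), rfl⟩)
      map_add' _ _ := rfl
      map_smul' _ _ := rfl } ⟨fun f g h => ?_, fun ⟨g, x⟩ => ?_⟩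
  · funext ⟨⟨j, k⟩, hjk⟩
    match k, hjk with
    | 0, hjk =>
      obtain rfl : j = i + 1 := hjk
      exact congrArg _root_.Prod.snd h
    | k + 1, hjk =>
      exact congrFun (congrArg _root_.Prod.fst h) ⟨(j, k), by dsimp at hjk ⊢; omega⟩
  · refine ⟨fun ⟨⟨j, k⟩, hjk⟩ => match k, hjk with
      | 0, hjk => (show j = i + 1 from hjk) ▸ x
      | k + 1, hjk => g ⟨(j, k), by dsimp at hjk ⊢; omega⟩, rfl⟩

section

open AlgebraicTopology

variable {F : Type*} [Ring F]
  [∀ Z : ModuleCat.{w} F, Projective Z]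
  (S : SimplicialObject (ModuleCat.{w} F ⥤ ModuleCat.{v} F)) [∀ n, (S.obj n).Additive]

/-- The `j`-th homology of `S` with constant coefficients `V`. -/
noncomputable abbrev homologyWithCoeff (j : ℕ) (V : ModuleCat.{w} F) :
    ModuleCat.{v} F :=
  (homologyOf (diag S ⋙ alternatingFaceMapComplex _) j).obj ((const _).obj V)

/-- Homology with coefficients only depends on the coefficients up to isomorphism. -/
noncomputable def homologyWithCoeffMapIso (j : ℕ) {V V' : ModuleCat.{w} F} (e : V ≅ V') :
    homologyWithCoeff S j V ≅ homologyWithCoeff S j V' :=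
  ((homologyOf (diag S ⋙ alternatingFaceMapComplex _) j).mapIso ((const _).mapIso e))

/-- The homology of the diagonal of a simplicial functor and a simplicial module with projective
values is the sum of the homologies with coefficients in the homology of the module. -/
theorem nonempty_homologyOf_diagonal_equiv (i : ℕ) (T : SimplicialObject (ModuleCat.{w} F)) :
    Nonempty ((homologyOf (diag S ⋙ alternatingFaceMapComplex _) i).obj T ≃ₗ[F]
      ⨁ jk : {jk : ℕ × ℕ // jk.1 + jk.2 = i}, homologyWithCoeff S jk.1.1
        ((homologyOf (alternatingFaceMapComplex _) jk.1.2).obj T)) := by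
  classical
  induction i generalizing T with
  | zero =>
    let e : Unique {jk : ℕ × ℕ // jk.1 + jk.2 = 0} :=
      ⟨⟨⟨(0, 0), rfl⟩⟩, fun x => Subtype.ext (by have := x.2; ext <;> simp <;> omega)⟩
    refine ⟨(homologyOfZeroIso (diag S ⋙ alternatingFaceMapComplex _) T ≪≫
      (homologyWithCoeffMapIso S 0 (homologyZeroIsoComponents T)).symm).toLinearEquiv ≪≫ₗ ?_⟩
    let M (jk : {jk : ℕ × ℕ // jk.1 + jk.2 = 0}) : Type v :=
      homologyWithCoeff S jk.1.1 ((homologyOf (alternatingFaceMapComplex _) jk.1.2).obj T)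
    exact (DirectSum.linearEquivFunOnFintype F _ M ≪≫ₗ LinearEquiv.piUnique F M).symm
  | succ i ih =>
    obtain ⟨ih⟩ := ih (loops T)
    let M (j k : ℕ) : Type v :=
      homologyWithCoeff S j ((homologyOf (alternatingFaceMapComplex _) k).obj T)
    obtain ⟨e⟩ := nonempty_antidiagonal_succ_equiv F M i
    -- The loops carry the summands with `k > 0`, because `H_k(loops T) ≅ H_{k+1}(T)`. The constant
    -- object of components is the summand `(i + 1, 0)`.
    refine ⟨(homologyOfSuccIso (diag S ⋙ alternatingFaceMapComplex _) T i).toLinearEquiv ≪≫ₗ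
      (ModuleCat.biprodIsoProd _ _).toLinearEquiv ≪≫ₗ LinearEquiv.prodCongr
        (ih ≪≫ₗ DFinsupp.mapRange.linearEquiv fun jk => ?_) ?_ ≪≫ₗ e.symm⟩
    · exact (homologyWithCoeffMapIso S _ (homologySuccIsoLoops T _).symm).toLinearEquiv
    · exact (homologyWithCoeffMapIso S _ (homologyZeroIsoComponents T).symm).toLinearEquiv

end

end CategoryTheory.SimplicialObject

end

/-! ### Comparison of the covers by path lifting -/

section

open unitInterval

section Covers

/-- Lifting of paths, with endpoints. -/
lemma IsCoveringMap.exists_path_lift {E X : Type*} [TopologicalSpace E] [TopologicalSpace X]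
    {p : E → X} (hp : IsCoveringMap p) {x y : X} (γ : Path x y) {e : E} (he : p e = x) :
    ∃ (e' : E) (Γ : Path e e'), ∀ t, p (Γ t) = γ t := by
  obtain ⟨Γ, h1, h2⟩ := hp.exists_path_lifts (γ : C(I, X)) e (by simp [he])
  exact ⟨Γ 1, ⟨Γ, h2, rfl⟩, fun t => congrFun h1 t⟩

/-- Lifting of maps along a contraction `K` of the source. -/
lemma IsCoveringMap.exists_contractible_lift {E X Δ : Type*} [TopologicalSpace E]
    [TopologicalSpace X] [TopologicalSpace Δ] {p : E → X} (hp : IsCoveringMap p) {K : C(I × Δ, Δ)}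
    {v : Δ} (h₀ : ∀ t, K (0, t) = v) (f : C(Δ, X)) {e : E}
    (he : p e = f v) :
    ∃ F : C(Δ, E), ∀ t, ∃ Γ : Path e (F t), ∀ s, p (Γ s) = f (K (s, t)) := by
  -- `f ∘ K` starts at a constant map, whose lift is the constant map at `e`; the homotopy lifting
  -- property does the rest.
  have H (t : Δ) : (f.comp K) (0, t) = p (ContinuousMap.const Δ e t) := by simp [h₀, he]
  let G := hp.liftHomotopy (f.comp K) (.const Δ e) H
  exact ⟨G.comp ⟨fun t => (1, t), by fun_prop⟩, fun t =>
    ⟨⟨G.comp ⟨fun s => (s, t), by fun_prop⟩, hp.liftHomotopy_zero _ _ H t, rfl⟩,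
      fun s => congrFun (hp.liftHomotopy_lifts _ _ H) (s, t)⟩⟩

variable {A : Type a} [CommGroup A]
    {X : Type u} [TopologicalSpace X] {Y : Type v} [TopologicalSpace Y] {x₀ : X} {y₀ : Y}
    {α : FundamentalGroup Y y₀ →* A}
    {E : Type w} [TopologicalSpace E] [MulAction A E]
    {p : C(E, Y)}
    {E' : Type z} [TopologicalSpace E'] [MulAction A E']
    {p' : C(E', X × Y)}

lemma IsAlphaCover.smul_left_cancel [ContinuousConstSMul A E] {x₀ : X}
    {α : FundamentalGroup X x₀ →* A} {p : C(E, X)}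
    (hp : IsAlphaCover α p) {g h : A} {e : E} (H : g • e = h • e) : g = h :=
  (inv_mul_eq_one.1 (hp.free (h⁻¹ * g) e (by rw [mul_smul, H, inv_smul_smul]))).symm

/-- The points `e` and `e'` are joined, by paths over the same path, to the same translate of the
base points `e₀` and `e₀'`. -/
def Linked (p : C(E, Y)) (p' : C(E', X × Y)) (A : Type a) [CommGroup A] [MulAction A E]
    [MulAction A E'] (e₀ : E) (e₀' : E') (e : E) (e' : E') : Prop :=
  ∃ (g : A) (γ : Path (g • e₀) e) (γ' : Path (g • e₀') e'), ∀ t, p (γ t) = (p' (γ' t)).2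

namespace Linked

variable {e₀ : E} {e₀' : E'} {e : E} {e' : E'}

lemma map_eq (h : Linked p p' A e₀ e₀' e e') : p e = (p' e').2 := by
  obtain ⟨g, γ, γ', h⟩ := h
  simpa using h 1

lemma trans_apply_eq {Z : Type*} {e₁ e₂ e₃ : E} {e₁' e₂' e₃' : E'} {γ : Path e₁ e₂}
    {δ : Path e₂ e₃} {γ' : Path e₁' e₂'} {δ' : Path e₂' e₃'} {f : E → Z} {f' : E' → Z}
    (h : ∀ t, f (γ t) = f' (γ' t)) (h' : ∀ t, f (δ t) = f' (δ' t)) (t : I) :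
    f ((γ.trans δ) t) = f' ((γ'.trans δ') t) := by
  rw [Path.trans_apply, Path.trans_apply]
  split_ifs
  · exact h _
  · exact h' _

lemma extend (h : Linked p p' A e₀ e₀' e e') {e₁ : E} {e₁' : E'} (δ : Path e e₁) (δ' : Path e' e₁')
    (hδ : ∀ t, p (δ t) = (p' (δ' t)).2) : Linked p p' A e₀ e₀' e₁ e₁' := by
  obtain ⟨g, γ, γ', h⟩ := h
  exact ⟨g, γ.trans δ, γ'.trans δ', trans_apply_eq (f := p) (f' := fun e' => (p' e').2) h hδ⟩

variable [ContinuousConstSMul A E] [ContinuousConstSMul A E'] (hp : IsAlphaCover α p)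
  (hp' : IsAlphaCover
    (α.comp (FundamentalGroup.map (ContinuousMap.snd : C(X × Y, Y)) (x₀, y₀))) p')

include hp hp'

lemma smul (h : Linked p p' A e₀ e₀' e e') (g : A) : Linked p p' A e₀ e₀' (g • e) (g • e') := by
  obtain ⟨k, γ, γ', h⟩ := h
  refine ⟨g * k, (γ.map (continuous_const_smul g)).cast (mul_smul _ _ _) rfl,
    (γ'.map (continuous_const_smul g)).cast (mul_smul _ _ _) rfl, fun t => ?_⟩
  simpa [hp.map_smul, hp'.map_smul] using h t

/-- Two translations which preserve a link agree. -/
lemma eq_of_smul (he₀ : p e₀ = y₀) (he₀' : p' e₀' = (x₀, y₀)) (h : Linked p p' A e₀ e₀' e e')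
    {g g' : A} (hg : Linked p p' A e₀ e₀' (g • e) (g' • e')) : g = g' := by
  obtain ⟨k, γ, γ', hγ⟩ := h
  obtain ⟨l, δ, δ', hδ⟩ := hg
  -- `ε` runs from `g • k • e₀` to `l • e₀` and `ε'` from `g' • k • e₀'` to `l • e₀'`, over the same
  -- loop of `Y`. Both monodromies are the value of `α` on this loop, so freeness of the actions
  -- forces `g = g'`.
  let ε := (γ.map (continuous_const_smul g)).trans δ.symm
  let ε' := (γ'.map (continuous_const_smul g')).trans δ'.symm
  have hε : ∀ t, p (ε t) = (p' (ε' t)).2 :=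
    trans_apply_eq (f := p) (f' := fun e' => (p' e').2)
      (fun t => by simpa [hp.map_smul, hp'.map_smul] using hγ t) (fun t => hδ _)
  have s₁ : y₀ = p (g • k • e₀) := by simp [hp.map_smul, he₀]
  have s₂ : y₀ = p (l • e₀) := by simp [hp.map_smul, he₀]
  have s₁' : (x₀, y₀) = p' (g' • k • e₀') := by simp [hp'.map_smul, he₀']
  have s₂' : (x₀, y₀) = p' (l • e₀') := by simp [hp'.map_smul, he₀']
  have h1 := hp.monodromy _ _ ε s₁ s₂
  have h2 := hp'.monodromy _ _ ε' s₁' s₂'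
  have h3 : ((ε'.map p'.continuous).cast s₁' s₂').map (continuous_snd) =
      (ε.map p.continuous).cast s₁ s₂ := by
    ext t
    exact (hε t).symm
  have h4 : FundamentalGroup.map (ContinuousMap.snd : C(X × Y, Y)) (x₀, y₀)
      (FundamentalGroup.fromPath (.mk ((ε'.map p'.continuous).cast s₁' s₂'))) =
      FundamentalGroup.fromPath (.mk ((ε.map p.continuous).cast s₁ s₂)) := by
    rw [← h3]
    rfl
  have h5 := h2.trans (congrArg (fun c => α c • g' • k • e₀') h4)
  rw [smul_smul, smul_smul] at h1 h5
  exact mul_left_cancel (mul_right_cancel ((hp.smul_left_cancel h1).symm.trans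
    (hp'.smul_left_cancel h5)))

end Linked

variable [ContinuousConstSMul A E] [ContinuousConstSMul A E'] (hp : IsAlphaCover α p)
  (hp' : IsAlphaCover
    (α.comp (FundamentalGroup.map (ContinuousMap.snd : C(X × Y, Y)) (x₀, y₀))) p')
  {e₀ : E} {e₀' : E'} (he₀ : p e₀ = y₀) (he₀' : p' e₀' = (x₀, y₀))

include hp hp' he₀ he₀'

/-- A path from `p' e'` to the base point lifts to one ending at a translate `g • e₀'`. Its reverse,
projected to `Y`, is lifted to `E` from `g • e₀`. -/
lemma Linked.exists_left [PathConnectedSpace X] [PathConnectedSpace Y] (e' : E') :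
    ∃ e, Linked p p' A e₀ e₀' e e' := by
  obtain ⟨β⟩ := PathConnectedSpace.joined (p' e') (x₀, y₀)
  obtain ⟨e₁, Γ, hΓ⟩ := hp'.isCoveringMap.exists_path_lift β rfl
  obtain ⟨g, rfl⟩ := hp'.transitive e₀' e₁ (by simpa [he₀'] using (hΓ 1).symm)
  obtain ⟨e, Δ, hΔ⟩ := hp.isCoveringMap.exists_path_lift
    (x := y₀) (((Γ.symm.map p'.continuous).map continuous_snd).cast
      (by simp [hp'.map_smul, he₀']) rfl) (e := g • e₀) (by simp [hp.map_smul, he₀])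
  exact ⟨e, g, Δ, Γ.symm, hΔ⟩

/-- The mirror argument. The path in `Y` is paired with a path from `x₀` to `x`, which makes the
first coordinate of the endpoint free to choose. -/
lemma Linked.exists_right [PathConnectedSpace X] [PathConnectedSpace Y] (x : X) (e : E) :
    ∃ e', Linked p p' A e₀ e₀' e e' ∧ (p' e').1 = x := by
  obtain ⟨β⟩ := PathConnectedSpace.joined (p e) y₀
  obtain ⟨ξ⟩ := PathConnectedSpace.joined x₀ x
  obtain ⟨e₁, Γ, hΓ⟩ := hp.isCoveringMap.exists_path_lift β rfl
  obtain ⟨g, rfl⟩ := hp.transitive e₀ e₁ (by simpa [he₀] using (hΓ 1).symm)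
  obtain ⟨e', Δ, hΔ⟩ := hp'.isCoveringMap.exists_path_lift
    (x := (x₀, y₀)) ((ξ.prod (Γ.symm.map p.continuous)).cast
      (by simp [hp.map_smul, he₀]) rfl) (e := g • e₀') (by simp [hp'.map_smul, he₀'])
  refine ⟨e', ⟨g, Γ.symm, Δ, fun t => ?_⟩, ?_⟩
  · rw [hΔ]; rfl
  · simpa using congrArg Prod.fst (hΔ 1)

/-- The comparison of an `α`-cover of `Y` and an `α'`-cover of `X × Y`: there is an equivariant map
`ψ` between them over the projection which, together with the projection to `X`, induces a bijection
on the maps from any contractible space. -/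
theorem exists_comparison [PathConnectedSpace X] [PathConnectedSpace Y] :
    ∃ ψ : E' → E, (∀ (g : A) e', ψ (g • e') = g • ψ e') ∧
      ∀ (Δ : Type) [TopologicalSpace Δ] [ContractibleSpace Δ],
        (∀ τ : C(Δ, E'), Continuous (ψ ∘ τ)) ∧
        ∀ (ξ : C(Δ, X)) (η : C(Δ, E)),
          ∃! τ : C(Δ, E'), (∀ t, (p' (τ t)).1 = ξ t) ∧ ∀ t, ψ (τ t) = η t := by
  choose ψ hψ using Linked.exists_left hp hp' he₀ he₀'
  -- Points linked to the same point lie in one fibre, hence differ by a translation, and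
  -- `Linked.eq_of_smul` shows that it is trivial.
  have left_unique {e₁ e₂ : E} {e' : E'} (h₁ : Linked p p' A e₀ e₀' e₁ e')
      (h₂ : Linked p p' A e₀ e₀' e₂ e') : e₁ = e₂ := by
    obtain ⟨g, rfl⟩ := hp.transitive e₁ e₂ (by rw [h₁.map_eq, h₂.map_eq])
    rw [← h₁.eq_of_smul hp hp' he₀ he₀' (g := g) (g' := 1) (by rwa [one_smul]) |>.symm, one_smul]
  have right_unique {e : E} {e₁ e₂ : E'} (h₁ : Linked p p' A e₀ e₀' e e₁)
      (h₂ : Linked p p' A e₀ e₀' e e₂) (h : (p' e₁).1 = (p' e₂).1) : e₁ = e₂ := by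
    obtain ⟨g, rfl⟩ := hp'.transitive e₁ e₂ (Prod.ext h (by rw [← h₁.map_eq, ← h₂.map_eq]))
    rw [← h₁.eq_of_smul hp hp' he₀ he₀' (g := 1) (g' := g) (by rwa [one_smul]), one_smul]
  refine ⟨ψ, fun g e' => left_unique (hψ _) ((hψ e').smul hp hp' g), fun Δ _ _ => ?_⟩
  obtain ⟨v, ⟨K⟩⟩ := id_nullhomotopic Δ
  -- The nullhomotopy ends at the constant map; reversed, it gives a path from `v` to each point,
  -- along which links are propagated.
  let K' : C(I × Δ, Δ) := ⟨fun s => K (σ s.1, s.2), by fun_prop⟩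
  have hK0 (t : Δ) : K' (0, t) = v := by simp [K']
  have hK1 (t : Δ) : K' (1, t) = t := by simp [K']
  let path (t : Δ) : Path v t := ⟨⟨fun s => K' (s, t), by fun_prop⟩, hK0 t, hK1 t⟩
  refine ⟨fun τ => ?_, fun ξ η => ?_⟩
  -- The continuous lift `F` of the projection of `τ` to `Y` is linked to `τ` at every point, so by
  -- uniqueness it is `ψ ∘ τ`.
  · obtain ⟨F, hF⟩ := hp.isCoveringMap.exists_contractible_lift hK0
      (ContinuousMap.snd.comp (p'.comp τ)) (hψ (τ v)).map_eq
    convert F.continuous using 1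
    funext t
    obtain ⟨Γ, hΓ⟩ := hF t
    exact left_unique (hψ _) ((hψ (τ v)).extend Γ ((path t).map τ.continuous) hΓ)
  · obtain ⟨e', he', hξ⟩ := Linked.exists_right hp hp' he₀ he₀' (ξ v) (η v)
    obtain ⟨F, hF⟩ := hp'.isCoveringMap.exists_contractible_lift hK0
      (ξ.prodMk (p.comp η)) (e := e') (Prod.ext hξ he'.map_eq.symm)
    have hF' (t : Δ) : Linked p p' A e₀ e₀' (η t) (F t) := by
      obtain ⟨Γ, hΓ⟩ := hF t
      exact he'.extend ((path t).map η.continuous) Γ fun s => by rw [hΓ s]; rfl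
    have hF₁ (t : Δ) : (p' (F t)).1 = ξ t := by
      obtain ⟨Γ, hΓ⟩ := hF t
      simpa [hK1] using congrArg Prod.fst (hΓ 1)
    refine ⟨F, ⟨hF₁, fun t => left_unique (hψ _) (hF' t)⟩, fun τ hτ => ?_⟩
    ext t
    exact right_unique (hτ.2 t ▸ hψ (τ t)) (hF' t) ((hτ.1 t).trans (hF₁ t).symm)

end Covers

end

/-! ### Twisted chains by generators and relations -/

section

namespace ModuleCat

section

variable {R : Type u} {S : Type w} [CommRing R] [CommRing S] (f : R →+* S) {M M' : ModuleCat.{v} R}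
  {N : Type*} [AddCommGroup N] [Module S N]

/-- The element `1 ⊗ m` of the extension of scalars. -/
noncomputable def extendScalarsOne (m : M) : (extendScalars f).obj M :=
  letI := f.toAlgebra
  ((1 : S) ⊗ₜ[R] m : S ⊗[R] M)

lemma extendScalarsOne_add (m n : M) :
    extendScalarsOne f (m + n) = extendScalarsOne f m + extendScalarsOne f n :=
  let := f.toAlgebra
  TensorProduct.tmul_add (R := R) (1 : S) m n

lemma extendScalarsOne_smul (r : R) (m : M) :
    extendScalarsOne f (r • m) = f r • extendScalarsOne f m := by
  let := f.toAlgebra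
  change ((1 : S) ⊗ₜ[R] (r • m) : S ⊗[R] M) = f r • ((1 : S) ⊗ₜ[R] m : S ⊗[R] M)
  rw [TensorProduct.tmul_smul, TensorProduct.smul_tmul', TensorProduct.smul_tmul',
    Algebra.smul_def, smul_eq_mul]
  rfl

lemma extendScalars_linearMap_ext {L L' : (extendScalars f).obj M →ₗ[S] N}
    (h : ∀ m, L (extendScalarsOne f m) = L' (extendScalarsOne f m)) : L = L' := by
  let := f.toAlgebra
  refine LinearMap.ext fun x => ?_
  induction x using TensorProduct.induction_on with
  | zero => exact (map_zero L).trans (map_zero L').symm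
  | add x y hx hy => exact (map_add L x y).trans ((congrArg₂ _ hx hy).trans (map_add L' x y).symm)
  | tmul s m =>
    change S at s
    have : (s ⊗ₜ[R] m : S ⊗[R] M) = s • ((1 : S) ⊗ₜ[R] m : S ⊗[R] M) := by
      rw [TensorProduct.smul_tmul', smul_eq_mul, mul_one]
    have h' : ∀ K : (extendScalars f).obj M →ₗ[S] N,
        K (s ⊗ₜ[R] m : S ⊗[R] M) = s • K (extendScalarsOne f m) := fun K =>
      (congrArg K this).trans (K.map_smul s (extendScalarsOne f m))
    exact (h' L).trans ((congrArg _ (h m)).trans (h' L').symm)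

/-- The universal property of the extension of scalars, with a target `N` in an arbitrary universe.
-/
lemma exists_extendScalars_lift (l : M →+ N) (hl : ∀ r m, l (r • m) = f r • l m) :
    ∃ L : (extendScalars f).obj M →ₗ[S] N, ∀ m, L (extendScalarsOne f m) = l m := by
  let := f.toAlgebra
  let : Module R N := Module.compHom N f
  have : IsScalarTower R S N := ⟨fun r s n => by
    rw [Algebra.smul_def, mul_smul]
    rfl⟩
  let l' : M →ₗ[R] N := { l with map_smul' := hl }
  exact ⟨(l'.liftBaseChange S : S ⊗[R] M →ₗ[S] N), fun m =>
    (LinearMap.liftBaseChange_tmul S l' (1 : S) m).trans (one_smul S _)⟩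

end

end ModuleCat

section SingularChains

open ModuleCat

variable (K : Type k) [Field K] (A : Type a) [CommGroup A] (E : Type v)
    [TopologicalSpace E] [MulAction A E] [ContinuousConstSMul A E]

/-- The twisted chains, as a simplicial vector space. -/
noncomputable def twistedChains :
    SimplicialObject (ModuleCat.{max v k a} (FracGroupRing K A)) :=
  (simplicialSingularChains A E ⋙ Rep.toModuleMonoidAlgebra) ⋙
    extendScalars.{a, max k a, v} (groupRingToFrac K A)

/-- Twisted homology is the homology of the twisted chains. -/
noncomputable def twistedHomologyIso (i : ℕ) :
    TwistedHomology K A E i ≅ (AlgebraicTopology.alternatingFaceMapComplex _ ⋙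
      HomologicalComplex.homologyFunctor _ _ i).obj (twistedChains K A E) :=
  (HomologicalComplex.homologyFunctor _ _ i).mapIso <| eqToIso <| Functor.congr_obj
    (AlgebraicTopology.map_alternatingFaceMapComplex (extendScalars.{a, max k a, v}
      (groupRingToFrac K A))) (simplicialSingularChains A E ⋙ Rep.toModuleMonoidAlgebra)

variable {A E}

/-- The twisted chain given by a singular simplex. -/
noncomputable def twistedSimplex {n : SimplexCategoryᵒᵖ} (σ : SingularSimplex E n.unop) :
    (twistedChains K A E).obj n :=
  extendScalarsOne (groupRingToFrac K A)
    (M := (simplicialSingularChains A E ⋙ Rep.toModuleMonoidAlgebra).obj n)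
    ((Finsupp.single σ 1 : SingularSimplex E n.unop →₀ ℤ) :)

/-- The unit of the coefficient field given by a group element. -/
noncomputable abbrev groupToFrac (g : A) : FracGroupRing K A :=
  groupRingToFrac K A (MonoidAlgebra.single g 1)

lemma twistedSimplex_smul {n : SimplexCategoryᵒᵖ} (g : A) (σ : SingularSimplex E n.unop) :
    twistedSimplex K (g • σ) = groupToFrac K g • twistedSimplex (A := A) K σ := by
  refine Eq.trans ?_ (extendScalarsOne_smul _ _ _)
  refine congrArg (extendScalarsOne _) ?_
  refine Eq.trans ?_ (Representation.single_smul (ρ := singularChainRep A E n.unop) 1 g _).symm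
  rw [one_smul]
  exact (Finsupp.mapDomain_single (f := fun σ : SingularSimplex E n.unop => g • σ)).symm

lemma twistedChains_map_simplex {m n : SimplexCategoryᵒᵖ} (f : m ⟶ n)
    (σ : SingularSimplex E m.unop) :
    (twistedChains K A E).map f (twistedSimplex K σ) = twistedSimplex K
      (σ.comp (SimplexCategory.toTop₀.map f.unop).hom) := by
  refine congrArg (extendScalarsOne _) ?_
  exact Finsupp.mapDomain_single (f := fun σ : SingularSimplex E m.unop =>
    σ.comp (SimplexCategory.toTop₀.map f.unop).hom)

variable {N : Type*} [AddCommGroup N] [Module (FracGroupRing K A) N]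

variable {K} in
lemma twistedChains_linearMap_ext {n : SimplexCategoryᵒᵖ}
    {L L' : (twistedChains K A E).obj n →ₗ[FracGroupRing K A] N}
    (h : ∀ σ, L (twistedSimplex K σ) = L' (twistedSimplex K σ)) : L = L' := by
  refine extendScalars_linearMap_ext _ fun m => ?_
  let b : (SingularSimplex E n.unop →₀ ℤ) →+ (twistedChains K A E).obj n :=
    .mk' (extendScalarsOne (groupRingToFrac K A)
      (M := (simplicialSingularChains A E ⋙ Rep.toModuleMonoidAlgebra).obj n))
      (fun c d => extendScalarsOne_add (groupRingToFrac K A)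
        (M := (simplicialSingularChains A E ⋙ Rep.toModuleMonoidAlgebra).obj n) c d)
  have : L.toAddMonoidHom.comp b = L'.toAddMonoidHom.comp b := by
    refine Finsupp.addHom_ext' fun σ => AddMonoidHom.ext_int ?_
    exact h σ
  exact DFunLike.congr_fun this m

/-- With `twistedChains_linearMap_ext` this presents the twisted chains: generators are the
simplices, relations identify `g • σ` with `g` times `σ`. No choice of orbit representatives is
needed. -/
lemma exists_twistedChains_lift {n : SimplexCategoryᵒᵖ} (φ : SingularSimplex E n.unop → N)
    (hφ : ∀ (g : A) σ, φ (g • σ) = groupToFrac K g • φ σ) :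
    ∃ L : (twistedChains K A E).obj n →ₗ[FracGroupRing K A] N,
      ∀ σ, L (twistedSimplex K σ) = φ σ := by
  let l : (SingularSimplex E n.unop →₀ ℤ) →ₗ[ℤ] N := Finsupp.lift N ℤ _ φ
  have hl (σ) : l (Finsupp.single σ 1) = φ σ := by simp [l]
  let ρ := singularChainRep A E n.unop
  have hlin (r : MonoidAlgebra ℤ A) (m : ρ.asModule) :
      l (r • m) = groupRingToFrac K A r • l m := by
    let l' : ρ.asModule →+ N := l.toAddMonoidHom
    change l' (r • m) = groupRingToFrac K A r • l' m
    induction r using MonoidAlgebra.induction_on with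
    | of g =>
      rw [MonoidAlgebra.of_apply, Representation.single_smul, one_smul]
      have : l ∘ₗ ρ g = (LinearMap.lsmul (FracGroupRing K A) N (groupToFrac K g)).restrictScalars ℤ
          ∘ₗ l := by
        refine Finsupp.lhom_ext' fun σ => LinearMap.ext_ring ?_
        have : ρ g (Finsupp.single σ 1) = Finsupp.single (g • σ) 1 :=
          Finsupp.mapDomain_single (f := fun σ : SingularSimplex E n.unop => g • σ)
        simp [this, hl, hφ]
      exact LinearMap.congr_fun this m
    | add r s hr hs => rw [add_smul, map_add, map_add, add_smul, hr, hs]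
    | smul c r hr => rw [smul_assoc, map_zsmul, map_zsmul, smul_assoc, hr]
  obtain ⟨L, hL⟩ := exists_extendScalars_lift (groupRingToFrac K A)
    (M := (simplicialSingularChains A E ⋙ Rep.toModuleMonoidAlgebra).obj n)
    (l.toAddMonoidHom :) hlin
  exact ⟨L, fun σ => (hL _).trans (hl σ)⟩

end SingularChains

end

/-! ### Rational chains and tensor products over the rationals -/

section

section RationalChains

open Limits

namespace ModuleCat

variable (R : Type) [Ring R]

/-- The coproduct of copies of the free module of rank one, as a module of finitely supported
functions. -/
noncomputable def sigmaConstRepr (ι : Type u) :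
    (sigmaConst.obj (ModuleCat.of R (ULift.{u} R))).obj ι ≃ₗ[R] ι →₀ R :=
  LinearEquiv.ofLinearMap
    (Sigma.desc (f := fun _ : ι => ModuleCat.of R (ULift.{u} R)) (P := ModuleCat.of R (ι →₀ R))
      fun i => ofHom (Finsupp.lsingle i ∘ₗ ULift.moduleEquiv.toLinearMap)).hom
    (Finsupp.linearCombination R fun i =>
      Sigma.ι (fun _ : ι => ModuleCat.of R (ULift.{u} R)) i (ULift.up 1))
    (by
      refine Finsupp.lhom_ext' fun i => LinearMap.ext_ring ?_
      simp only [LinearMap.comp_apply, Finsupp.lsingle_apply, Finsupp.linearCombination_single,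
        one_smul]
      exact congr($(Sigma.ι_desc (fun i => ofHom (Y := ι →₀ R)
        (Finsupp.lsingle i ∘ₗ ULift.moduleEquiv.toLinearMap)) i) (ULift.up 1)))
    (by
      refine congrArg Hom.hom (Sigma.hom_ext (f := fun _ : ι => ModuleCat.of R (ULift.{u} R))
        (ofHom _) (𝟙 _) fun i => ?_)
      rw [Category.comp_id, ofHom_comp, ofHom_hom, Sigma.ι_desc_assoc]
      refine hom_ext (LinearMap.ext fun r => ?_)
      change Finsupp.linearCombination R _ (Finsupp.single i r.down) = _
      rw [Finsupp.linearCombination_single, ← map_smul]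
      exact congrArg _ (ULift.ext _ _ (mul_one r.down)))

/-- The canonical basis of a coproduct of copies of the free module of rank one. -/
noncomputable def sigmaConstBasis {ι : Type u} {κ : Type*} (e : ι ≃ κ) :
    Module.Basis κ R ((sigmaConst.obj (ModuleCat.of R (ULift.{u} R))).obj ι) :=
  .ofRepr (sigmaConstRepr R ι ≪≫ₗ Finsupp.domLCongr e)

lemma sigmaConstBasis_apply {ι : Type u} {κ : Type*} (e : ι ≃ κ) (i : ι) :
    sigmaConstBasis R e (e i) =
      Sigma.ι (fun _ : ι => ModuleCat.of R (ULift.{u} R)) i (ULift.up 1) := by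
  have : (Finsupp.domLCongr (R := R) e).symm (Finsupp.single (e i) (1 : R)) =
      Finsupp.single i 1 := by
    rw [LinearEquiv.symm_apply_eq, Finsupp.domLCongr_single]
  refine (congrArg (sigmaConstRepr R ι).symm this).trans ?_
  exact (Finsupp.linearCombination_single R 1 i).trans (one_smul R _)

lemma sigmaConst_map_basis {ι ι' : Type u} {κ κ' : Type*} (e : ι ≃ κ) (e' : ι' ≃ κ') (f : ι ⟶ ι')
    (g : κ → κ') (h : ∀ i, g (e i) = e' (f i)) (x : κ) :
    (sigmaConst.obj (ModuleCat.of R (ULift.{u} R))).map f (sigmaConstBasis R e x) =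
      sigmaConstBasis R e' (g x) := by
  obtain ⟨i, rfl⟩ := e.surjective x
  rw [h, sigmaConstBasis_apply, sigmaConstBasis_apply]
  have := Sigma.ι_desc (fun i => Sigma.ι (fun _ : ι' => ModuleCat.of R (ULift.{u} R)) (f i)) i
  exact congr($this (ULift.up 1))

end ModuleCat

variable (X : Type u) [TopologicalSpace X]

/-- The rational singular chains, as a simplicial vector space. -/
noncomputable def rationalChains : SimplicialObject (ModuleCat.{u} ℚ) :=
  ((SimplicialObject.whiskering _ _).obj (sigmaConst.obj (ModuleCat.of ℚ (ULift ℚ)))).obj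
    (TopCat.toSSet.obj (TopCat.of X))

example (j : ℕ) : RationalHomology X j =
  ((AlgebraicTopology.alternatingFaceMapComplex _).obj (rationalChains X)).homology j := rfl

/-- The simplices of the singular simplicial set. -/
noncomputable def singularSimplexEquiv (n : SimplexCategoryᵒᵖ) :
    (TopCat.toSSet.obj (TopCat.of X)).obj n ≃ SingularSimplex X n.unop :=
  TopCat.toSSetObjEquiv (TopCat.of X) n

variable {X} in
/-- The basis of the rational chains given by the singular simplices. -/
noncomputable def rationalChainsBasis (n : SimplexCategoryᵒᵖ) :
    Module.Basis (SingularSimplex X n.unop) ℚ ((rationalChains X).obj n) :=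
  ModuleCat.sigmaConstBasis ℚ (singularSimplexEquiv X n)

lemma rationalChains_map_basis {m n : SimplexCategoryᵒᵖ} (f : m ⟶ n)
    (σ : SingularSimplex X m.unop) :
    (rationalChains X).map f (rationalChainsBasis m σ) = rationalChainsBasis n
      (σ.comp (SimplexCategory.toTop₀.map f.unop).hom) := by
  exact ModuleCat.sigmaConst_map_basis ℚ (singularSimplexEquiv X m) (singularSimplexEquiv X n)
    ((TopCat.toSSet.obj (TopCat.of X)).map f)
    (fun σ => σ.comp (SimplexCategory.toTop₀.map f.unop).hom) (fun _ => rfl) σ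

end RationalChains

section

open scoped ModuleCat

variable {F : Type w} [CommRing F] [Algebra ℚ F]

/-- The functor `M ↦ (V ↦ V ⊗[ℚ] M)`. -/
noncomputable def rationalTensor :
    ModuleCat.{u} ℚ ⥤ ModuleCat.{v} F ⥤ ModuleCat.{max u v} F where
  obj M :=
    { obj V := ModuleCat.of F (V ⊗[ℚ] M)
      map f := ModuleCat.ofHom (TensorProduct.AlgebraTensorModule.map f.hom .id)
      map_id V := ModuleCat.hom_ext TensorProduct.AlgebraTensorModule.map_id
      map_comp f g := by
        refine ModuleCat.hom_ext ?_
        ext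
        rfl }
  map h :=
    { app V := ModuleCat.ofHom (TensorProduct.AlgebraTensorModule.map .id h.hom)
      naturality V W f := by
        refine ModuleCat.hom_ext ?_
        ext
        rfl }
  map_id M := by
    ext V : 2
    exact ModuleCat.hom_ext TensorProduct.AlgebraTensorModule.map_id
  map_comp f g := by
    ext V : 2
    refine ModuleCat.hom_ext ?_
    ext
    rfl

instance (M : ModuleCat.{u} ℚ) : ((rationalTensor (F := F)).obj M).Additive where
  map_add {_ _ f g} := ModuleCat.hom_ext
    (TensorProduct.AlgebraTensorModule.map_add_left f.hom g.hom LinearMap.id)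

instance (V : ModuleCat.{v} F) : ((rationalTensor.{u} (F := F)).flip.obj V).Additive where
  map_add {_ _ f g} := ModuleCat.hom_ext
    (TensorProduct.AlgebraTensorModule.map_add_right LinearMap.id f.hom g.hom)

/-- Every `ℚ`-vector space is flat, so tensoring with `V` is exact. -/
instance (V : ModuleCat.{v} F) : ((rationalTensor.{u} (F := F)).flip.obj V).PreservesHomology :=
  Functor.preservesHomology_of_map_exact _ fun S hS => by
    rw [ShortComplex.ShortExact.moduleCat_exact_iff_function_exact] at hS ⊢
    exact Module.Flat.lTensor_exact V hS

end

end

/-! ### Twisted chains of the product as a diagonal -/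

section

section

open CategoryTheory.SimplicialObject AlgebraicTopology

namespace CategoryTheory.SimplicialObject

/-- An exact functor commutes with homology. -/
noncomputable def homologyOfCompIso {C D : Type*} [Category* C] [Category* D] [Abelian C]
    [Abelian D] (G : C ⥤ D) [G.Additive] [G.PreservesHomology] (i : ℕ) (V : SimplicialObject C) :
    (homologyOf (alternatingFaceMapComplex D) i).obj (V ⋙ G : SimplicialObject D) ≅
      G.obj ((homologyOf (alternatingFaceMapComplex C) i).obj V) :=
  (HomologicalComplex.homologyFunctor _ _ i).mapIso
      (CategoryTheory.eqToIso (Functor.congr_obj (map_alternatingFaceMapComplex G) V).symm :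
        _ ≅ (G.mapHomologicalComplex _).obj ((alternatingFaceMapComplex C).obj V)) ≪≫
    (((alternatingFaceMapComplex C).obj V).sc i).mapHomologyIso G

/-- Isomorphic simplicial modules in different universes have isomorphic homology. -/
theorem nonempty_homologyOf_equiv {F : Type a} [Ring F] {V : SimplicialObject (ModuleCat.{v} F)}
    {W : SimplicialObject (ModuleCat.{w} F)} (e : ∀ n, V.obj n ≃ₗ[F] W.obj n)
    (he : ∀ {m n} (f : m ⟶ n) x, e n (V.map f x) = W.map f (e m x)) (i : ℕ) :
    Nonempty ((homologyOf (alternatingFaceMapComplex (ModuleCat.{v} F)) i).obj V ≃ₗ[F]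
      (homologyOf (alternatingFaceMapComplex (ModuleCat.{w} F)) i).obj W) := by
  -- Both objects are lifted to a common universe; lifting is exact, so it commutes with homology.
  let iso : (V ⋙ ModuleCat.uliftFunctor.{w, v} F : SimplicialObject (ModuleCat.{max v w} F)) ≅
      (W ⋙ ModuleCat.uliftFunctor.{v, w} F : SimplicialObject (ModuleCat.{max v w} F)) :=
    NatIso.ofComponents
      (fun n => (ULift.moduleEquiv ≪≫ₗ e n ≪≫ₗ ULift.moduleEquiv.symm).toModuleIso)
      fun {m n} f => ModuleCat.hom_ext (LinearMap.ext fun x => ULift.ext _ _ (he f x.down))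
  have j := (homologyOfCompIso (ModuleCat.uliftFunctor.{w, v} F) i V).symm ≪≫
    (homologyOf (alternatingFaceMapComplex _) i).mapIso iso ≪≫
    homologyOfCompIso (ModuleCat.uliftFunctor.{v, w} F) i W
  exact ⟨ULift.moduleEquiv.symm ≪≫ₗ j.toLinearEquiv ≪≫ₗ ULift.moduleEquiv⟩

end CategoryTheory.SimplicialObject

section

variable (X : Type u) [TopologicalSpace X] (F : Type z) [CommRing F] [Algebra ℚ F]

/-- The singular chains of `X` with coefficients, as a simplicial functor of the coefficients. -/
noncomputable def chainsWithCoeff :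
    SimplicialObject (ModuleCat.{v} F ⥤ ModuleCat.{max u v} F) :=
  rationalChains X ⋙ rationalTensor

instance (n : SimplexCategoryᵒᵖ) : ((chainsWithCoeff.{u, v} X F).obj n).Additive :=
  inferInstanceAs (rationalTensor.obj _).Additive

open scoped ModuleCat

variable {F}

/-- Homology with coefficients in a vector space over an extension of `ℚ`. -/
noncomputable def homologyWithCoeffIso (j : ℕ) (V : ModuleCat.{v} F) :
    homologyWithCoeff (chainsWithCoeff.{u, v} X F) j V ≅
      ModuleCat.of F (V ⊗[ℚ] RationalHomology X j) :=
  (homologyOf (alternatingFaceMapComplex _) j).mapIso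
      -- In each degree the two objects coincide; the operators differ only by the image of an
      -- identity of `V`.
      (NatIso.ofComponents (fun _ => Iso.refl _) fun f => by
        refine (Category.comp_id _).trans ((Eq.trans ?_ (Category.id_comp _).symm))
        exact (congrArg (· ≫ _) (CategoryTheory.Functor.map_id _ _)).trans (Category.id_comp _) :
        (diag (chainsWithCoeff.{u, v} X F)).obj ((const _).obj V) ≅
          (rationalChains X ⋙ rationalTensor.flip.obj V : SimplicialObject _)) ≪≫
    homologyOfCompIso (rationalTensor.flip.obj V) j (rationalChains X)

end

section

open scoped ModuleCat

variable {K : Type k} [Field K] [CharZero K] {A : Type a} [CommGroup A]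
  {X : Type u} [TopologicalSpace X]
  {E : Type w} [TopologicalSpace E] [MulAction A E] [ContinuousConstSMul A E]
  {E' : Type z} [TopologicalSpace E'] [MulAction A E'] [ContinuousConstSMul A E']

lemma twistedChains_tensor_linearMap_ext {N : Type*} [AddCommGroup N] [Module (FracGroupRing K A) N]
    {n : SimplexCategoryᵒᵖ}
    {L L' : (twistedChains K A E).obj n ⊗[ℚ] (rationalChains X).obj n →ₗ[FracGroupRing K A] N}
    (h : ∀ σ ξ, L (twistedSimplex K σ ⊗ₜ rationalChainsBasis n ξ) =
      L' (twistedSimplex K σ ⊗ₜ rationalChainsBasis n ξ)) : L = L' := by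
  let : Module ℚ N := Module.compHom N (algebraMap ℚ (FracGroupRing K A))
  have : IsScalarTower ℚ (FracGroupRing K A) N := ⟨fun q x m => by
    rw [Algebra.smul_def, mul_smul]; rfl⟩
  refine TensorProduct.AlgebraTensorModule.curry_injective ?_
  refine twistedChains_linearMap_ext fun σ => ?_
  exact (rationalChainsBasis n).ext fun ξ => h σ ξ

/-- If the singular simplices of `E'` are the pairs of singular simplices of `X` and of `E`, the
twisted chains of `E'` are the tensor product of those of `E` and the rational chains of `X`. -/
theorem exists_twistedChains_equiv {n : SimplexCategoryᵒᵖ}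
    (e : SingularSimplex E' n.unop ≃ SingularSimplex X n.unop × SingularSimplex E n.unop)
    (he : ∀ (g : A) τ, e (g • τ) = ((e τ).1, g • (e τ).2)) :
    ∃ L : (twistedChains K A E').obj n ≃ₗ[FracGroupRing K A]
        (twistedChains K A E).obj n ⊗[ℚ] (rationalChains X).obj n,
      ∀ τ, L (twistedSimplex K τ) = twistedSimplex K (e τ).2 ⊗ₜ rationalChainsBasis n (e τ).1 := by
  obtain ⟨L, hL⟩ := exists_twistedChains_lift K (A := A) (n := n) (N :=
      (twistedChains K A E).obj n ⊗[ℚ] (rationalChains X).obj n)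
    (fun τ : SingularSimplex E' n.unop => twistedSimplex K (e τ).2 ⊗ₜ rationalChainsBasis n (e τ).1)
    fun g τ => by
      rw [he, twistedSimplex_smul]; rfl
  have he' (g : A) ξ σ : e.symm (ξ, g • σ) = g • e.symm (ξ, σ) := by
    rw [Equiv.symm_apply_eq, he, Equiv.apply_symm_apply]
  -- The inverse is built one simplex `ξ` of `X` at a time, where `σ ↦ e⁻¹ (ξ, σ)` is equivariant,
  -- and then extended linearly over the basis of simplices `ξ`.
  have H (ξ : SingularSimplex X n.unop) := exists_twistedChains_lift K (A := A) (n := n)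
    (N := (twistedChains K A E').obj n)
    (fun σ : SingularSimplex E n.unop => twistedSimplex K (e.symm (ξ, σ)))
    fun g σ => by
      rw [he', twistedSimplex_smul]
  choose M hM using H
  let L' := TensorProduct.AlgebraTensorModule.lift ((rationalChainsBasis n).constr ℚ M).flip
  have hL' σ ξ : L' (twistedSimplex K σ ⊗ₜ rationalChainsBasis n ξ) =
      twistedSimplex K (e.symm (ξ, σ)) := by
    refine Eq.trans ?_ (hM ξ σ)
    exact LinearMap.congr_fun ((rationalChainsBasis n).constr_basis ℚ M ξ) (twistedSimplex K σ)
  refine ⟨LinearEquiv.ofLinearMap L L' ?_ ?_, hL⟩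
  · refine twistedChains_tensor_linearMap_ext fun σ ξ => ?_
    rw [LinearMap.comp_apply, hL', hL, Equiv.apply_symm_apply]
    rfl
  · refine twistedChains_linearMap_ext fun τ => ?_
    rw [LinearMap.comp_apply, hL, hL', Equiv.symm_apply_apply]
    rfl

/-- If the singular simplices of `E'` are the pairs of singular simplices of `X` and of `E`, the
twisted homology of `E'` is that of the diagonal of the chains of `X` and the twisted chains of
`E`. -/
theorem nonempty_twistedHomology_equiv
    (e : ∀ n, SingularSimplex E' n ≃ SingularSimplex X n × SingularSimplex E n)
    (he : ∀ n (g : A) τ, e n (g • τ) = ((e n τ).1, g • (e n τ).2))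
    (hf : ∀ {m n} (f : m ⟶ n) τ, e m (τ.comp (SimplexCategory.toTop₀.map f).hom) =
      ((e n τ).1.comp (SimplexCategory.toTop₀.map f).hom,
        (e n τ).2.comp (SimplexCategory.toTop₀.map f).hom)) (i : ℕ) :
    Nonempty (TwistedHomology K A E' i ≃ₗ[FracGroupRing K A]
      (homologyOf (diag (chainsWithCoeff X (FracGroupRing K A)) ⋙
        alternatingFaceMapComplex _) i).obj (twistedChains K A E)) := by
  choose L hL using fun n : SimplexCategoryᵒᵖ => exists_twistedChains_equiv (K := K) (e n.unop)
    (he n.unop)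
  obtain ⟨l⟩ := nonempty_homologyOf_equiv (V := twistedChains K A E')
    (W := (diag (chainsWithCoeff X (FracGroupRing K A))).obj (twistedChains K A E)) L (fun f => by
      refine LinearMap.congr_fun (f := (L _).toLinearMap ∘ₗ ((twistedChains K A E').map f).hom)
        (g := (((diag (chainsWithCoeff X (FracGroupRing K A))).obj (twistedChains K A E)).map f).hom
          ∘ₗ (L _).toLinearMap) ?_
      refine twistedChains_linearMap_ext fun τ => ?_
      trans L _ ((twistedChains K A E').map f (twistedSimplex K τ))
      · rfl
      trans (twistedChains K A E).map f (twistedSimplex K (e _ τ).2) ⊗ₜ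
        (rationalChains X).map f (rationalChainsBasis _ (e _ τ).1)
      · rw [twistedChains_map_simplex, hL, hf, twistedChains_map_simplex,
          rationalChains_map_basis]
      · refine Eq.trans ?_ (congrArg (((diag (chainsWithCoeff X (FracGroupRing K A))).obj
          (twistedChains K A E)).map f) (hL _ τ)).symm
        rfl) i
  exact ⟨(twistedHomologyIso K A E' i).toLinearEquiv ≪≫ₗ l⟩

end

end

end

/-! ### Simplices of the cover of the product, and the theorem -/

section

instance (n : SimplexCategory) : ContractibleSpace (SimplexCategory.toTop₀.obj n) :=
  (convex_stdSimplex ℝ (Fin (n.len + 1))).contractibleSpace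
    ⟨stdSimplex.vertex (S := ℝ) 0, (stdSimplex.vertex (S := ℝ) 0).2⟩

variable {A : Type a} [CommGroup A] {X : Type u} [TopologicalSpace X] [PathConnectedSpace X]
  {Y : Type v} [TopologicalSpace Y] [PathConnectedSpace Y] {x₀ : X} {y₀ : Y}
  {α : FundamentalGroup Y y₀ →* A}
  {E : Type w} [TopologicalSpace E] [MulAction A E] [ContinuousConstSMul A E]
  {p : C(E, Y)} (hp : IsAlphaCover α p)
  {E' : Type z} [TopologicalSpace E'] [MulAction A E'] [ContinuousConstSMul A E']
  {p' : C(E', X × Y)} (hp' : IsAlphaCover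
      (α.comp (FundamentalGroup.map (ContinuousMap.snd : C(X × Y, Y)) (x₀, y₀))) p')

include hp hp' in
/-- The singular simplices of the cover of a product are the pairs of singular simplices of the
first factor and of the cover of the second factor. -/
theorem exists_singularSimplex_equiv :
    ∃ e : ∀ n, SingularSimplex E' n ≃ SingularSimplex X n × SingularSimplex E n,
      (∀ n (g : A) τ, e n (g • τ) = ((e n τ).1, g • (e n τ).2)) ∧
      ∀ {m n} (f : m ⟶ n) τ, e m (τ.comp (SimplexCategory.toTop₀.map f).hom) =
        ((e n τ).1.comp (SimplexCategory.toTop₀.map f).hom,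
          (e n τ).2.comp (SimplexCategory.toTop₀.map f).hom) := by
  obtain ⟨e₀, he₀⟩ := hp.surjective y₀
  obtain ⟨e₀', he₀'⟩ := hp'.surjective (x₀, y₀)
  obtain ⟨ψ, hψ, H⟩ := exists_comparison hp hp' he₀ he₀'
  let q n (τ : SingularSimplex E' n) : SingularSimplex X n × SingularSimplex E n :=
    (ContinuousMap.fst.comp (p'.comp τ), ⟨ψ ∘ τ, (H _).1 τ⟩)
  have hq n : Function.Bijective (q n) := by
    refine Function.bijective_iff_existsUnique _ |>.mpr fun ⟨ξ, η⟩ => ?_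
    obtain ⟨τ, ⟨h1, h2⟩, h⟩ := (H (SimplexCategory.toTop₀.obj n)).2 ξ η
    refine ⟨τ, Prod.ext (ContinuousMap.ext h1) (ContinuousMap.ext h2), fun τ' h' => h τ' ?_⟩
    exact ⟨DFunLike.congr_fun (congrArg Prod.fst h'), DFunLike.congr_fun (congrArg Prod.snd h')⟩
  refine ⟨fun n => .ofBijective (q n) (hq n), fun n g τ => ?_, fun f τ => rfl⟩
  exact Prod.ext (ContinuousMap.ext fun t => congrArg Prod.fst (hp'.map_smul g (τ t)))
    (ContinuousMap.ext fun t => hψ g (τ t))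

end

section

/-- `ℤⁿ` has the unique products property, which passes to `A` and excludes zero divisors in the
group ring. Thus `FracGroupRing K A` is a field. -/
lemma isDomain_monoidAlgebra_of_mulEquiv (K : Type k) [Field K] {A : Type a} [CommGroup A] {n : ℕ}
    (e : A ≃* Multiplicative (Fin n → ℤ)) : IsDomain (MonoidAlgebra K A) := by
  have : TwoUniqueProds (Multiplicative (Fin n → ℤ)) := inferInstance
  have : UniqueProds A :=
    (TwoUniqueProds.of_injective_mulHom e.toMulHom e.injective this).toUniqueProds
  have : NoZeroDivisors (MonoidAlgebra K A) := inferInstance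
  exact NoZeroDivisors.to_isDomain _

lemma ModuleCat.projective_of_field {F : Type a} [Field F] (V : ModuleCat.{max a v} F) :
    Projective V :=
  have : Module.Projective F V := Module.Projective.of_free
  inferInstance

end

theorem theorem2p5 {A : Type a} [CommGroup A] (n : ℕ)
    (hA : Nonempty (A ≃* Multiplicative (Fin n → ℤ)))
    (K : Type k) [Field K] [CharZero K]
    {X : Type u} [TopologicalSpace X] [PathConnectedSpace X]
    {Y : Type v} [TopologicalSpace Y] [PathConnectedSpace Y] (x₀ : X) (y₀ : Y)
    (α : FundamentalGroup Y y₀ →* A)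
    -- the `α`-cover of `Y`
    {E : Type w} [TopologicalSpace E] [MulAction A E] [ContinuousConstSMul A E]
    (p : C(E, Y)) (hp : IsAlphaCover α p)
    -- the `α'`-cover of `X × Y`, where `α'` is the pullback of `α` along the projection
    {E' : Type z} [TopologicalSpace E'] [MulAction A E'] [ContinuousConstSMul A E']
    (p' : C(E', X × Y)) 
    (hp' : IsAlphaCover
      (α.comp (FundamentalGroup.map (ContinuousMap.snd : C(X × Y, Y)) (x₀, y₀))) p')
    (i : ℕ) :
    Nonempty (TwistedHomology K A E' i ≃ₗ[FracGroupRing K A]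
      ⨁ jk : {jk : ℕ × ℕ // jk.1 + jk.2 = i},
        (TwistedHomology K A E jk.1.2 ⊗[ℚ] RationalHomology X jk.1.1)) := by
  obtain ⟨eA⟩ := hA
  have := isDomain_monoidAlgebra_of_mulEquiv K eA
  -- Projectivity of all modules provides every splitting used in the dimension shifting.
  have (V : ModuleCat.{max w k a} (FracGroupRing K A)) : Projective V :=
    ModuleCat.projective_of_field V
  obtain ⟨e, he, hf⟩ := exists_singularSimplex_equiv hp hp'
  obtain ⟨l⟩ := nonempty_twistedHomology_equiv (K := K) e he hf i
  obtain ⟨l'⟩ := SimplicialObject.nonempty_homologyOf_diagonal_equiv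
    (chainsWithCoeff X (FracGroupRing K A)) i (twistedChains K A E)
  refine ⟨l ≪≫ₗ l' ≪≫ₗ DFinsupp.mapRange.linearEquiv fun jk => ?_⟩
  exact ((SimplicialObject.homologyWithCoeffMapIso _ _ (twistedHomologyIso K A E jk.1.2).symm) ≪≫
    homologyWithCoeffIso X jk.1.1 (TwistedHomology K A E jk.1.2)).toLinearEquiv
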